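/- Let $n\ge 2$ and let $\Omega\subset\mathbb{R}^n$ be a bounded open set with smooth boundary and $0\in\Omega$. Let $\omega_{n-1}$ be the surface measure of the unit sphere in $\mathbb{R}^n$, $\alpha_n=n\,\omega_{n-1}^{1/(n-1)}$, and let $\alpha>0$, $\beta\in[0,n)$ satisfy $\frac{\alpha}{\alpha_n}+\frac{\beta}{n}=1$. Put $$\mathcal{B}_1(\Omega)=\{v\in W_0^{1,n}(\Omega): \|\nabla v\|_{L^n(\Omega)}\le 1\},\qquad F_\Omega(v)=\int_\Omega\frac{e^{\alpha|v|^{n/(n-1)}}-1}{|x|^\beta}\,dx .$$ A sequence $\{v_i\}\subset W^{1,n}_0(\Omega)$ concentrates at $0$ if $\lim_{i\to\infty}\|\nabla v_i\|_{L^n(\Omega)}=1$ and $\lim_{i\to\infty}\int_{\Omega\setminus B_\epsilon(0)}|\nabla v_i|^n\,dx=0$ for every $\epsilon>0$. Let $$F_\Omega^\delta(0)=\sup\Big\{\limsup_{i\to\infty}F_\Omega(v_i)\ :\ \{v_i\}\subset\mathcal{B}_1(\Omega)\text{ concentrates at }0\Big\}.$$ Suppose that $\{u_i\}_{i\in\mathbb{N}}\subset\mathcal{B}_1(\Omega)\cap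 C^\infty(\Omega)$ is a sequence of nonnegative functions which concentrates at $0$ and satisfies $\lim_{i\to\infty}F_\Omega(u_i)=F_\Omega^\delta(0)$. Then for every $r>0$ there exist $j\in\mathbb{N}$ and $k_j\in[1,2]$ such that $$\{x\in\Omega: u_j(x)\ge k_j\}\cap B_r(0)\ne\emptyset$$ and every connected component $A$ of $\{x\in\Omega: u_j(x)\ge k_j\}$ has the following two properties: if $A\cap B_r(0)\neq\emptyset$, then $A\subset B_{2r}(0)$; and $A$ has smooth boundary. -/

import Mathlib

open Set Filter Topology MeasureTheory
open scoped ENNReal ContDiff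

namespace MoserTrudinger

/-- `φ ∈ C_c^∞(Ω)`. -/
def IsTestFunction {n : ℕ} (Ω : Set (EuclideanSpace ℝ (Fin n)))
    (φ : EuclideanSpace ℝ (Fin n) → ℝ) : Prop :=
  ContDiff ℝ ∞ φ ∧ HasCompactSupport φ ∧ tsupport φ ⊆ Ω

/-- `G` is the weak (distributional) gradient of `v` on the open set `Ω`. -/
def HasWeakGradient {n : ℕ} (Ω : Set (EuclideanSpace ℝ (Fin n)))
    (v : EuclideanSpace ℝ (Fin n) → ℝ)
    (G : EuclideanSpace ℝ (Fin n) → EuclideanSpace ℝ (Fin n)) : Prop :=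
  LocallyIntegrableOn v Ω volume ∧ LocallyIntegrableOn G Ω volume ∧
    ∀ φ : EuclideanSpace ℝ (Fin n) → ℝ, IsTestFunction Ω φ →
      ∫ x in Ω, v x • gradient φ x = -∫ x in Ω, φ x • G x

open Classical in
/-- The weak gradient of `v` on `Ω` (unique almost everywhere on `Ω` when it exists; the value is
`0` when there is none). -/
noncomputable def weakGrad {n : ℕ} (Ω : Set (EuclideanSpace ℝ (Fin n)))
    (v : EuclideanSpace ℝ (Fin n) → ℝ) : EuclideanSpace ℝ (Fin n) → EuclideanSpace ℝ (Fin n) :=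
  if h : ∃ G, HasWeakGradient Ω v G then h.choose else 0

/-- `v ∈ W^{1,n}(Ω)`, where `n` is the dimension. Only the values of `v` on `Ω` matter. -/
def MemW1n {n : ℕ} (Ω : Set (EuclideanSpace ℝ (Fin n)))
    (v : EuclideanSpace ℝ (Fin n) → ℝ) : Prop :=
  (∃ G, HasWeakGradient Ω v G) ∧ MemLp v (n : ℝ≥0∞) (volume.restrict Ω) ∧
    MemLp (weakGrad Ω v) (n : ℝ≥0∞) (volume.restrict Ω)

/-- `v ∈ W_0^{1,n}(Ω)`: the closure of `C_c^∞(Ω)` in `W^{1,n}(Ω)`. -/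
def MemW1n0 {n : ℕ} (Ω : Set (EuclideanSpace ℝ (Fin n)))
    (v : EuclideanSpace ℝ (Fin n) → ℝ) : Prop :=
  MemW1n Ω v ∧ ∀ ε : ℝ≥0∞, 0 < ε → ∃ φ : EuclideanSpace ℝ (Fin n) → ℝ, IsTestFunction Ω φ ∧
    eLpNorm (fun x => v x - φ x) (n : ℝ≥0∞) (volume.restrict Ω) < ε ∧
    eLpNorm (fun x => weakGrad Ω v x - gradient φ x) (n : ℝ≥0∞) (volume.restrict Ω) < ε

/-- `‖∇v‖_{L^n(Ω)}`. -/
noncomputable def gradNorm {n : ℕ} (Ω : Set (EuclideanSpace ℝ (Fin n)))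
    (v : EuclideanSpace ℝ (Fin n) → ℝ) : ℝ≥0∞ :=
  eLpNorm (weakGrad Ω v) (n : ℝ≥0∞) (volume.restrict Ω)

/-- The set `{v ∈ W_0^{1,n}(Ω) : ‖∇v‖_{L^n} ≤ 1}`. -/
def unitBall {n : ℕ} (Ω : Set (EuclideanSpace ℝ (Fin n))) :
    Set (EuclideanSpace ℝ (Fin n) → ℝ) :=
  {v | MemW1n0 Ω v ∧ gradNorm Ω v ≤ 1}

/-- The sequence `u` in `W_0^{1,n}(Ω)` concentrates at `x₀`. -/
def ConcentratesAt {n : ℕ} (Ω : Set (EuclideanSpace ℝ (Fin n)))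
    (u : ℕ → EuclideanSpace ℝ (Fin n) → ℝ) (x₀ : EuclideanSpace ℝ (Fin n)) : Prop :=
  Tendsto (fun i => gradNorm Ω (u i)) atTop (𝓝 1) ∧
    ∀ ε : ℝ, 0 < ε →
      Tendsto (fun i => ∫⁻ x in Ω \ Metric.ball x₀ ε, ‖weakGrad Ω (u i) x‖ₑ ^ n) atTop (𝓝 0)

/-- `ω_{n-1}`, the surface measure of the unit sphere of `ℝⁿ`. -/
noncomputable def sphereArea (n : ℕ) : ℝ :=
  ((volume : Measure (EuclideanSpace ℝ (Fin n))).toSphere).real Set.univ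

/-- `α_n = n ω_{n-1}^{1/(n-1)}`. -/
noncomputable def alphaCrit (n : ℕ) : ℝ :=
  (n : ℝ) * sphereArea n ^ (1 / ((n : ℝ) - 1))

/-- `F_Ω(v) = ∫_Ω (exp(α |v|^{n/(n-1)}) - 1) / |x|^β dx`; the integrand is nonnegative, and the
integral is taken with values in `[0, ∞]`. -/
noncomputable def F {n : ℕ} (α β : ℝ) (Ω : Set (EuclideanSpace ℝ (Fin n)))
    (v : EuclideanSpace ℝ (Fin n) → ℝ) : ℝ≥0∞ :=
  ∫⁻ x in Ω, ENNReal.ofReal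
    ((Real.exp (α * |v x| ^ ((n : ℝ) / ((n : ℝ) - 1))) - 1) / ‖x‖ ^ β)

/-- `F_Ω^δ(x₀)`: the supremum of `limsup F_Ω(u_i)` over the sequences of `unitBall Ω` that
concentrate at `x₀`. -/
noncomputable def Fdelta {n : ℕ} (α β : ℝ) (Ω : Set (EuclideanSpace ℝ (Fin n)))
    (x₀ : EuclideanSpace ℝ (Fin n)) : ℝ≥0∞ :=
  sSup {s | ∃ u : ℕ → EuclideanSpace ℝ (Fin n) → ℝ,
    (∀ i, u i ∈ unitBall Ω) ∧ ConcentratesAt Ω u x₀ ∧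
      s = limsup (fun i => F α β Ω (u i)) atTop}

/-- The set `A` has smooth boundary: near each of its boundary points, `∂A` is the zero set of a
smooth function `ψ` with nonvanishing differential at the point, and the interior of `A` is
`{ψ < 0}`. So locally an open such `A` is `{ψ < 0}`, and a closed one is `{ψ ≤ 0}`. -/
def HasSmoothBoundary {n : ℕ} (A : Set (EuclideanSpace ℝ (Fin n))) : Prop :=
  ∀ p ∈ frontier A, ∃ (U : Set (EuclideanSpace ℝ (Fin n))) (ψ : EuclideanSpace ℝ (Fin n) → ℝ),
    IsOpen U ∧ p ∈ U ∧ ContDiffOn ℝ ∞ ψ U ∧ fderiv ℝ ψ p ≠ 0 ∧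
      frontier A ∩ U = {x ∈ U | ψ x = 0} ∧ interior A ∩ U = {x ∈ U | ψ x < 0}

end MoserTrudinger

/-!
If `v` is a limit of test functions, its means over the ring `a/2 < |z - x| < a` and over the ring
of half that size differ by at most a constant times the `n`-th root of the energy of `v` near `x`.
Summing over the dyadic scales bounds `|v x|` wherever the energies of the dyadic balls around `x`
decay geometrically, and the remaining points are covered by balls whose radii are controlled by
the energy. Hence `∫ (exp (α |v|^(n/(n-1))) - 1)` is small over regions of small energy, and a
concentrating sequence that stays bounded near `0` has `F → 0`.

Moser's truncated logarithms form a concentrating sequence along which `F` stays away from `0`, so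
a maximizing sequence `u` must exceed `2` arbitrarily near `0`. A connected subset of `{u ≥ 1}` that
meets `B(0, r)` and leaves `B(0, 2 * r)` costs a fixed amount of energy outside `B(0, r / 2)`, which
is excluded for large indices. The same argument at a point of `∂Ω`, where the zero extension of `u`
vanishes on a fixed proportion of every small ball, keeps the closure of a component inside `Ω`. The
boundary of a component is then made of pieces of a level set, which is smooth for almost every
level in `[1, 2]` by Sard's theorem.
-/

namespace MoserTrudinger

section Sard

universe u

/-- A smooth real function on an open subset of `E` has a Lebesgue null set of critical values. -/
def SardProperty (E : Type*) [NormedAddCommGroup E] [NormedSpace ℝ E] : Prop :=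
  ∀ (f : E → ℝ) (U : Set E), IsOpen U → (∀ x ∈ U, ContDiffAt ℝ ∞ f x) →
    volume (f '' {x ∈ U | fderiv ℝ f x = 0}) = 0

theorem measure_image_null_of_locally_null {X Y : Type*} [TopologicalSpace X]
    [SecondCountableTopology X] [MeasurableSpace Y] {μ : Measure Y} {f : X → Y} {s : Set X}
    (h : ∀ x ∈ s, ∃ t ∈ 𝓝[s] x, μ (f '' t) = 0) : μ (f '' s) = 0 :=
  measure_null_of_locally_null (μ := OuterMeasure.comap f μ.toOuterMeasure) s h

theorem norm_iteratedFDeriv_sub_le_of_eq_zero {E F : Type*} [NormedAddCommGroup E]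
    [NormedSpace ℝ E] [NormedAddCommGroup F] [NormedSpace ℝ F] {f : E → F} {V : Set E} {M : ℝ}
    (hV : Convex ℝ V) (hf : ∀ x ∈ V, ContDiffAt ℝ ∞ f x) {x y : E} (hx : x ∈ V) (hy : y ∈ V)
    (k : ℕ) {j : ℕ} (hM : ∀ z ∈ V, ‖iteratedFDeriv ℝ (j + k + 1) f z‖ ≤ M)
    (h0 : ∀ i, j < i → i ≤ j + k → iteratedFDeriv ℝ i f x = 0) :
    ‖iteratedFDeriv ℝ j f y - iteratedFDeriv ℝ j f x‖ ≤ M * ‖y - x‖ ^ (k + 1) := by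
  have hdiff : ∀ z ∈ V, DifferentiableAt ℝ (iteratedFDeriv ℝ j f) z := fun z hz =>
    (hf z hz).differentiableAt_iteratedFDeriv (by exact_mod_cast ENat.natCast_lt_top j)
  induction k generalizing j y with
  | zero =>
    rw [zero_add, pow_one]
    refine hV.norm_image_sub_le_of_norm_fderiv_le hdiff (fun z hz => ?_) hx hy
    rw [norm_fderiv_iteratedFDeriv]
    exact hM z hz
  | succ k ih =>
    have hM0 : 0 ≤ M := (norm_nonneg _).trans (hM x hx)
    have hsucc : ∀ z ∈ V, ‖iteratedFDeriv ℝ (j + 1) f z‖ ≤ M * ‖z - x‖ ^ (k + 1) := by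
      intro z hz
      have := ih (j := j + 1) hz (by rwa [show j + 1 + k + 1 = j + (k + 1) + 1 by omega])
        (fun i hi hik => h0 i (by omega) (by omega)) fun z hz =>
          (hf z hz).differentiableAt_iteratedFDeriv (by exact_mod_cast ENat.natCast_lt_top _)
      rwa [h0 (j + 1) (by omega) (by omega), sub_zero] at this
    have hmean := (hV.inter (convex_closedBall x ‖y - x‖)).norm_image_sub_le_of_norm_fderiv_le
      (𝕜 := ℝ) (C := M * ‖y - x‖ ^ (k + 1)) (fun z hz => hdiff z hz.1) (fun z hz => ?_)
      ⟨hx, by simp⟩ ⟨hy, by simp [dist_eq_norm]⟩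
    · rwa [mul_assoc, ← pow_succ] at hmean
    · rw [norm_fderiv_iteratedFDeriv]
      have hzy : ‖z - x‖ ≤ ‖y - x‖ := by simpa [dist_eq_norm] using hz.2
      exact (hsucc z hz.1).trans (by gcongr)

theorem exists_straightening {E F : Type*} [NormedAddCommGroup E] [NormedSpace ℝ E]
    [CompleteSpace E] [NormedAddCommGroup F] [NormedSpace ℝ F] [FiniteDimensional ℝ F]
    {m : WithTop ℕ∞} (hm : m ≠ 0) {g : E → F} {x₀ : E} {W : Set E} (hW : W ∈ 𝓝 x₀)
    (hg : ∀ x ∈ W, ContDiffAt ℝ m g x) (hsurj : (fderiv ℝ g x₀).range = ⊤) :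
    ∃ Ψ : OpenPartialHomeomorph E (F × (fderiv ℝ g x₀).ker), x₀ ∈ Ψ.source ∧ Ψ.source ⊆ W ∧
      (∀ x ∈ Ψ.source, (Ψ x).1 = g x) ∧ ∀ z ∈ Ψ.target, ContDiffAt ℝ m Ψ.symm z := by
  have : CompleteSpace F := FiniteDimensional.complete ℝ F
  have hstrict := (hg x₀ (mem_of_mem_nhds hW)).hasStrictFDerivAt hm
  let data := HasStrictFDerivAt.implicitFunctionDataOfComplemented g _ hstrict hsurj
    (ContinuousLinearMap.ker_closedComplemented_of_finiteDimensional_range _)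
  let Φ := data.toOpenPartialHomeomorph
  have hΦsmooth : ∀ x ∈ W, ContDiffAt ℝ m Φ x := fun x hx =>
    (hg x hx).prodMk (ContinuousLinearMap.contDiff _ |>.comp (contDiff_id.sub contDiff_const)
      |>.contDiffAt)
  have hinvertible : ∀ᶠ x in 𝓝 x₀, fderiv ℝ Φ x ∈ range
      ((↑) : (E ≃L[ℝ] F × (fderiv ℝ g x₀).ker) → E →L[ℝ] F × (fderiv ℝ g x₀).ker) := by
    have hcont : ContinuousAt (fderiv ℝ Φ) x₀ :=
      ((hΦsmooth x₀ (mem_of_mem_nhds hW)).fderiv_right (m := 0)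
        (by simpa using ENat.one_le_iff_ne_zero_withTop.2 hm)).continuousAt
    refine hcont ?_
    have hfd := data.hasStrictFDerivAt.hasFDerivAt.fderiv
    change fderiv ℝ Φ x₀ = _ at hfd
    rw [hfd]
    exact ContinuousLinearEquiv.nhds _
  obtain ⟨V, hVW, hVo, hx₀V⟩ := mem_nhds_iff.1 (inter_mem hinvertible hW)
  refine ⟨Φ.restrOpen V hVo, ⟨data.pt_mem_toOpenPartialHomeomorph_source, hx₀V⟩,
    fun x hx => (hVW hx.2).2, fun x _ => rfl, fun z hz => ?_⟩
  have hzV := hVW ((Φ.restrOpen V hVo).map_target hz).2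
  obtain ⟨e, he⟩ := hzV.1
  refine (Φ.restrOpen V hVo).contDiffAt_symm (f₀' := e) hz ?_ (hΦsmooth _ hzV.2)
  rw [he]
  exact ((hΦsmooth _ hzV.2).differentiableAt hm).hasFDerivAt

variable {E : Type u} [NormedAddCommGroup E] [NormedSpace ℝ E] {f g : E → ℝ} {U : Set E}

theorem exists_fderiv_iteratedFDeriv_apply_ne_zero {k : ℕ} {x : E} (hf : ContDiffAt ℝ ∞ f x)
    (hx : iteratedFDeriv ℝ (k + 1) f x ≠ 0) :
    ∃ w : Fin k → E, fderiv ℝ (fun y => iteratedFDeriv ℝ k f y w) x ≠ 0 := by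
  by_contra! h
  refine hx (ContinuousMultilinearMap.ext fun w => ?_)
  have hdiff : DifferentiableAt ℝ (iteratedFDeriv ℝ k f) x :=
    hf.differentiableAt_iteratedFDeriv (by exact_mod_cast ENat.natCast_lt_top k)
  have happly := ((ContinuousMultilinearMap.apply ℝ (fun _ : Fin k => E) ℝ
    (Fin.tail w)).hasFDerivAt.comp x hdiff.hasFDerivAt).fderiv
  rw [iteratedFDeriv_succ_apply_left]
  exact congrArg (fun T : E →L[ℝ] ℝ => T (w 0)) (happly.symm.trans (h (Fin.tail w)))

theorem critical_subset_flat_union (U : Set E) (f : E → ℝ) (k : ℕ) :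
    {x ∈ U | fderiv ℝ f x = 0} ⊆
      {x ∈ U | ∀ i, 0 < i → i ≤ k → iteratedFDeriv ℝ i f x = 0} ∪
        ⋃ j, {x ∈ U | fderiv ℝ f x = 0 ∧ iteratedFDeriv ℝ j f x = 0 ∧
          iteratedFDeriv ℝ (j + 1) f x ≠ 0} := by
  classical
  rintro x ⟨hxU, hx⟩
  by_cases h : ∃ i, iteratedFDeriv ℝ (i + 1) f x ≠ 0
  · have hpos : Nat.find h ≠ 0 := fun h0 => Nat.find_spec h (by
      rw [h0, ← norm_eq_zero, norm_iteratedFDeriv_one, hx, norm_zero])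
    obtain ⟨j, hj⟩ := Nat.exists_eq_succ_of_ne_zero hpos
    refine Or.inr (mem_iUnion.2 ⟨j + 1, hxU, hx, ?_, by
      rw [← Nat.succ_eq_add_one j, ← hj]; exact Nat.find_spec h⟩)
    exact not_not.1 (Nat.find_min h (by omega))
  · push Not at h
    refine Or.inl ⟨hxU, fun i hi _ => ?_⟩
    rw [← Nat.sub_add_cancel hi]
    exact h (i - 1)

variable [FiniteDimensional ℝ E]

theorem volume_image_eq_zero_of_holderOnWith {s : Set E} {C r : NNReal} (hf : HolderOnWith C r f s)
    (hr : Module.finrank ℝ E < r) : volume (f '' s) = 0 := by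
  let _ : MeasurableSpace E := borel E
  have _ : BorelSpace E := ⟨rfl⟩
  have hE : μH[r] (univ : Set E) = 0 := hausdorffMeasure_of_dimH_lt (by
    rw [Real.dimH_univ_eq_finrank]
    exact_mod_cast hr)
  have himage := hf.hausdorffMeasure_image_le ((Nat.cast_nonneg _).trans_lt hr) zero_le_one
  rw [hausdorffMeasure_real, mul_one, measure_mono_null (subset_univ s) hE, mul_zero] at himage
  exact le_antisymm himage zero_le

theorem volume_image_eq_zero_of_iteratedFDeriv_eq_zero (hU : IsOpen U)
    (hf : ∀ x ∈ U, ContDiffAt ℝ ∞ f x) {k : ℕ} (hk : Module.finrank ℝ E ≤ k) :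
    volume (f '' {x ∈ U | ∀ i, 0 < i → i ≤ k → iteratedFDeriv ℝ i f x = 0}) = 0 := by
  refine measure_image_null_of_locally_null fun x hx => ?_
  set M : ℝ := ‖iteratedFDeriv ℝ (k + 1) f x‖ + 1
  have hbounded : ∀ᶠ y in 𝓝 x, ‖iteratedFDeriv ℝ (k + 1) f y‖ < M :=
    ((hf x hx.1).iteratedFDeriv_right (m := 0)
      (by exact_mod_cast le_top)).continuousAt.norm.eventually_lt_const (lt_add_one _)
  obtain ⟨ε, hε, hball⟩ := Metric.mem_nhds_iff.1 (inter_mem hbounded (hU.mem_nhds hx.1))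
  refine ⟨_, inter_mem_nhdsWithin _ (Metric.ball_mem_nhds x hε),
    volume_image_eq_zero_of_holderOnWith (C := M.toNNReal) (r := (k + 1 : ℕ)) ?_
      (by exact_mod_cast Nat.lt_succ_of_le hk)⟩
  intro y hy z hz
  have hM : 0 ≤ M := by positivity
  have htaylor : ‖f y - f z‖ ≤ M * ‖y - z‖ ^ (k + 1) := by
    have := norm_iteratedFDeriv_sub_le_of_eq_zero (convex_ball x ε)
      (fun w hw => hf w (hball hw).2) hz.2 hy.2 k (j := 0) (M := M)
      (fun w hw => by rw [zero_add]; exact le_of_lt (hball hw).1)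
      fun i hi hik => hz.1.2 i hi (by omega)
    rwa [iteratedFDeriv_zero_eq_comp, Function.comp_apply, Function.comp_apply, ← map_sub,
      LinearIsometryEquiv.norm_map] at this
  rw [edist_eq_enorm_sub, edist_eq_enorm_sub, ← ofReal_norm, ← ofReal_norm, NNReal.coe_natCast,
    ENNReal.rpow_natCast, ← ENNReal.ofReal_pow (norm_nonneg _)]
  change _ ≤ ENNReal.ofReal M * _
  rw [← ENNReal.ofReal_mul hM]
  exact ENNReal.ofReal_le_ofReal htaylor

theorem exists_nhds_volume_image_critical_inter_eq_zero (hU : IsOpen U)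
    (hf : ∀ x ∈ U, ContDiffAt ℝ ∞ f x) (hg : ∀ x ∈ U, ContDiffAt ℝ ∞ g x) {x : E} (hx : x ∈ U)
    (hgx : fderiv ℝ g x ≠ 0) (hker : SardProperty (fderiv ℝ g x).ker) :
    ∃ V ∈ 𝓝 x, volume (f '' ({y ∈ U | fderiv ℝ f y = 0 ∧ g y = 0} ∩ V)) = 0 := by
  have hsurj : (fderiv ℝ g x).range = ⊤ :=
    Module.Dual.range_eq_top_of_ne_zero fun h => hgx (ContinuousLinearMap.coe_injective h)
  obtain ⟨Ψ, hxΨ, hΨU, hΨfst, hΨsmooth⟩ :=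
    exists_straightening (by simp) (hU.mem_nhds hx) hg hsurj
  let ι : (fderiv ℝ g x).ker → ℝ × (fderiv ℝ g x).ker := fun z => (0, z)
  have hι : ContDiff ℝ ∞ ι := contDiff_const.prodMk contDiff_id
  have hparam : ∀ z ∈ ι ⁻¹' Ψ.target, ContDiffAt ℝ ∞ (Ψ.symm ∘ ι) z :=
    fun z hz => (hΨsmooth _ hz).comp z hι.contDiffAt
  refine ⟨Ψ.source, Ψ.open_source.mem_nhds hxΨ, measure_mono_null ?_ <|
    hker (f ∘ Ψ.symm ∘ ι) (ι ⁻¹' Ψ.target) (Ψ.open_target.preimage hι.continuous) fun z hz =>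
      (hf _ (hΨU (Ψ.map_target hz))).comp z (hparam z hz)⟩
  rintro _ ⟨y, ⟨⟨hyU, hfy, hgy⟩, hyΨ⟩, rfl⟩
  have hιy : ι (Ψ y).2 = Ψ y := Prod.ext (by rw [hΨfst y hyΨ, hgy]) rfl
  have hsymm : (Ψ.symm ∘ ι) (Ψ y).2 = y := by rw [Function.comp_apply, hιy, Ψ.left_inv hyΨ]
  have htarget : ι (Ψ y).2 ∈ Ψ.target := hιy ▸ Ψ.map_source hyΨ
  refine ⟨(Ψ y).2, ⟨htarget, ?_⟩, congrArg f hsymm⟩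
  rw [fderiv_comp _ (by rw [hsymm]; exact (hf y hyU).differentiableAt (by simp))
    ((hparam _ htarget).differentiableAt (by simp)), hsymm, hfy, ContinuousLinearMap.zero_comp]

theorem volume_image_critical_inter_iteratedFDeriv_ne_zero (hU : IsOpen U)
    (hf : ∀ x ∈ U, ContDiffAt ℝ ∞ f x)
    (hker : ∀ L : E →L[ℝ] ℝ, L ≠ 0 → SardProperty L.ker) (k : ℕ) :
    volume (f '' {x ∈ U | fderiv ℝ f x = 0 ∧ iteratedFDeriv ℝ k f x = 0 ∧
      iteratedFDeriv ℝ (k + 1) f x ≠ 0}) = 0 := by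
  refine measure_image_null_of_locally_null fun x ⟨hxU, _, _, hx⟩ => ?_
  obtain ⟨w, hw⟩ := exists_fderiv_iteratedFDeriv_apply_ne_zero (hf x hxU) hx
  have hg : ∀ y ∈ U, ContDiffAt ℝ ∞ (fun z => iteratedFDeriv ℝ k f z w) y := fun y hy =>
    (ContinuousMultilinearMap.apply ℝ (fun _ : Fin k => E) ℝ w).contDiff.contDiffAt.comp y
      ((hf y hy).iteratedFDeriv_right (by exact_mod_cast le_top))
  obtain ⟨V, hV, hnull⟩ :=
    exists_nhds_volume_image_critical_inter_eq_zero hU hf hg hxU hw (hker _ hw)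
  refine ⟨_, inter_mem_nhdsWithin _ hV, measure_mono_null (image_mono ?_) hnull⟩
  rintro y ⟨⟨hyU, hfy, hky, _⟩, hyV⟩
  exact ⟨⟨hyU, hfy, by rw [hky, zero_apply]⟩, hyV⟩

theorem sardProperty_of_finrank_eq (d : ℕ) : ∀ (E : Type u) [NormedAddCommGroup E]
    [NormedSpace ℝ E] [FiniteDimensional ℝ E], Module.finrank ℝ E = d → SardProperty E := by
  induction d with
  | zero =>
    intro E _ _ _ hE f U _ _
    have : Subsingleton E := Module.finrank_zero_iff.1 hE
    exact ((subsingleton_of_subsingleton (s := {x ∈ U | fderiv ℝ f x = 0})).image f).measure_zero _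
  | succ d ih =>
    intro E _ _ _ hE f U hU hf
    have hker : ∀ L : E →L[ℝ] ℝ, L ≠ 0 → SardProperty L.ker := fun L hL =>
      ih L.ker <| Nat.succ_injective <|
        (Module.Dual.finrank_ker_add_one_of_ne_zero (K := ℝ) (f := L.toLinearMap)
          fun h => hL (ContinuousLinearMap.coe_injective h)).trans hE
    refine measure_mono_null (image_mono (critical_subset_flat_union U f (d + 1))) ?_
    rw [image_union, image_iUnion]
    exact measure_union_null (volume_image_eq_zero_of_iteratedFDeriv_eq_zero hU hf hE.le)
      (measure_iUnion_null (volume_image_critical_inter_iteratedFDeriv_ne_zero hU hf hker))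

theorem exists_mem_Icc_fderiv_ne_zero (hU : IsOpen U) (hf : ContDiffOn ℝ ∞ f U) {a b : ℝ}
    (hab : a < b) : ∃ k ∈ Icc a b, ∀ x ∈ U, f x = k → fderiv ℝ f x ≠ 0 := by
  by_contra! h
  have hsub : Icc a b ⊆ f '' {x ∈ U | fderiv ℝ f x = 0} := fun k hk =>
    let ⟨x, hxU, hxk, hx⟩ := h k hk
    ⟨x, ⟨hxU, hx⟩, hxk⟩
  have hnull := measure_mono_null hsub
    (sardProperty_of_finrank_eq _ E rfl f U hU fun x hx => hf.contDiffAt (hU.mem_nhds hx))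
  rw [Real.volume_Icc, ENNReal.ofReal_eq_zero] at hnull
  linarith

end Sard

section SuperlevelComponent

theorem subset_connectedComponentIn_of_inter_nonempty {X : Type*}
    [TopologicalSpace X] {S V : Set X} {x : X} (hV : IsPreconnected V) (hVS : V ⊆ S)
    (h : (V ∩ connectedComponentIn S x).Nonempty) : V ⊆ connectedComponentIn S x := by
  obtain ⟨y, hyV, hyA⟩ := h
  rw [connectedComponentIn_eq hyA]
  exact hV.subset_connectedComponentIn hyV hVS

theorem isClosed_connectedComponentIn_superlevel {X : Type*} [TopologicalSpace X] {Ω : Set X}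
    {u : X → ℝ} {k : ℝ} {x : X} (hu : ContinuousOn u Ω)
    (hcl : closure (connectedComponentIn {x ∈ Ω | k ≤ u x} x) ⊆ Ω) :
    IsClosed (connectedComponentIn {x ∈ Ω | k ≤ u x} x) := by
  set A := connectedComponentIn {x ∈ Ω | k ≤ u x} x
  have hk : MapsTo u (closure A) (Ici k) := by
    have hkA : MapsTo u A (Ici k) := fun y hy => (connectedComponentIn_subset _ _ hy).2
    simpa only [closure_Ici] using hkA.closure_of_continuousOn (hu.mono hcl)
  refine isClosed_of_closure_subset fun y hy => ?_
  obtain ⟨z, hz⟩ := closure_nonempty_iff.1 ⟨y, hy⟩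
  exact subset_connectedComponentIn_of_inter_nonempty (S := {x ∈ Ω | k ≤ u x}) (x := x)
    isPreconnected_connectedComponentIn.closure (fun y hy => ⟨hcl hy, hk hy⟩)
    ⟨z, subset_closure hz, hz⟩ hy

section NormedSpace

variable {E : Type*} [NormedAddCommGroup E] [NormedSpace ℝ E] {Ω : Set E} {u : E → ℝ} {k : ℝ}
  {p x : E}

theorem mem_interior_connectedComponentIn_of_lt (hΩ : IsOpen Ω) (hu : ContinuousOn u Ω)
    (hp : p ∈ connectedComponentIn {x ∈ Ω | k ≤ u x} x) (hk : k < u p) :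
    p ∈ interior (connectedComponentIn {x ∈ Ω | k ≤ u x} x) := by
  have hpΩ : Ω ∈ 𝓝 p := hΩ.mem_nhds (connectedComponentIn_subset _ _ hp).1
  have hgt : ∀ᶠ y in 𝓝 p, k < u y := (hu.continuousAt hpΩ).eventually_const_lt hk
  obtain ⟨ε, hε, hball⟩ := Metric.mem_nhds_iff.1 (inter_mem hgt hpΩ)
  refine mem_interior.2 ⟨Metric.ball p ε, ?_, Metric.isOpen_ball, Metric.mem_ball_self hε⟩
  exact subset_connectedComponentIn_of_inter_nonempty
    (convex_ball p ε).isPreconnected (fun y hy => ⟨(hball hy).2, le_of_lt (hball hy).1⟩)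
    ⟨p, Metric.mem_ball_self hε, hp⟩

theorem mem_interior_connectedComponentIn_iff (hΩ : IsOpen Ω) (hu : ContinuousOn u Ω)
    (hreg : fderiv ℝ u p ≠ 0) (hp : p ∈ connectedComponentIn {x ∈ Ω | k ≤ u x} x) :
    p ∈ interior (connectedComponentIn {x ∈ Ω | k ≤ u x} x) ↔ k < u p := by
  refine ⟨fun hint => ?_, mem_interior_connectedComponentIn_of_lt hΩ hu hp⟩
  refine lt_of_le_of_ne (connectedComponentIn_subset _ _ hp).2 fun hk => ?_
  have hmin : IsLocalMin u p := by
    filter_upwards [mem_interior_iff_mem_nhds.1 hint] with z hz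
    exact hk ▸ (connectedComponentIn_subset _ _ hz).2
  exact hreg hmin.fderiv_eq_zero

theorem exists_isOpen_isPreconnected_superlevel [CompleteSpace E] {W : Set E} (hW : W ∈ 𝓝 p)
    (hu : ∀ x ∈ W, ContDiffAt ℝ 1 u x) (hp : fderiv ℝ u p ≠ 0) :
    ∃ U, IsOpen U ∧ p ∈ U ∧ U ⊆ W ∧ ∀ k, IsPreconnected {y ∈ U | k ≤ u y} := by
  obtain ⟨Ψ, hpΨ, hΨW, hΨfst, -⟩ := exists_straightening (by simp) hW hu
    (Module.Dual.range_eq_top_of_ne_zero fun h => hp (ContinuousLinearMap.coe_injective h))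
  obtain ⟨ε, hε, hball⟩ := Metric.isOpen_iff.1 Ψ.open_target _ (Ψ.map_source hpΨ)
  refine ⟨Ψ.source ∩ Ψ ⁻¹' Metric.ball (Ψ p) ε, Ψ.isOpen_inter_preimage Metric.isOpen_ball,
    ⟨hpΨ, Metric.mem_ball_self hε⟩, fun y hy => hΨW hy.1, fun k => ?_⟩
  have himage : {y ∈ Ψ.source ∩ Ψ ⁻¹' Metric.ball (Ψ p) ε | k ≤ u y} =
      Ψ.symm '' (Metric.ball (Ψ p) ε ∩ {z | k ≤ z.1}) := by
    ext y
    constructor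
    · rintro ⟨⟨hyΨ, hy⟩, hky⟩
      exact ⟨Ψ y, ⟨hy, by rw [mem_ofPred_eq, hΨfst y hyΨ]; exact hky⟩, Ψ.left_inv hyΨ⟩
    · rintro ⟨z, ⟨hz, hkz⟩, rfl⟩
      have hzΨ := Ψ.map_target (hball hz)
      refine ⟨⟨hzΨ, ?_⟩, ?_⟩
      · rwa [mem_preimage, Ψ.right_inv (hball hz)]
      · rwa [← hΨfst _ hzΨ, Ψ.right_inv (hball hz)]
  rw [himage]
  exact ((convex_ball _ _).inter (convex_halfSpace_ge (LinearMap.fst ℝ ℝ _).isLinear k)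
    ).isPreconnected.image _ (Ψ.continuousOn_symm.mono (inter_subset_left.trans hball))

end NormedSpace

theorem hasSmoothBoundary_connectedComponentIn {n : ℕ} {Ω : Set (EuclideanSpace ℝ (Fin n))}
    {u : EuclideanSpace ℝ (Fin n) → ℝ} {k : ℝ} (hΩ : IsOpen Ω) (hu : ContDiffOn ℝ ∞ u Ω)
    (hreg : ∀ x ∈ Ω, u x = k → fderiv ℝ u x ≠ 0) {x : EuclideanSpace ℝ (Fin n)}
    (hcl : closure (connectedComponentIn {x ∈ Ω | k ≤ u x} x) ⊆ Ω) :
    HasSmoothBoundary (connectedComponentIn {x ∈ Ω | k ≤ u x} x) := by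
  set A := connectedComponentIn {x ∈ Ω | k ≤ u x} x
  have hAS : A ⊆ {x ∈ Ω | k ≤ u x} := connectedComponentIn_subset _ _
  have hclosed : closure A = A :=
    (isClosed_connectedComponentIn_superlevel hu.continuousOn hcl).closure_eq
  intro p hp
  have hpA : p ∈ A := hclosed ▸ hp.1
  have hpk : u p = k := (hAS hpA).2.antisymm' <| not_lt.1 fun h =>
    hp.2 (mem_interior_connectedComponentIn_of_lt hΩ hu.continuousOn hpA h)
  obtain ⟨U, hUo, hpU, hUΩ, hUconn⟩ := exists_isOpen_isPreconnected_superlevel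
    (hΩ.mem_nhds (hAS hpA).1)
    (fun y hy => (hu.contDiffAt (hΩ.mem_nhds hy)).of_le (by exact_mod_cast le_top))
    (hreg p (hAS hpA).1 hpk)
  have hmem : ∀ y ∈ U, y ∈ A ↔ k ≤ u y := fun y hy => ⟨fun h => (hAS h).2, fun hky =>
    subset_connectedComponentIn_of_inter_nonempty (S := {x ∈ Ω | k ≤ u x}) (x := x) (hUconn k)
      (fun z hz => ⟨hUΩ hz.1, hz.2⟩) ⟨p, ⟨hpU, hpk.ge⟩, hpA⟩ ⟨hy, hky⟩⟩
  have hint : ∀ y ∈ U, y ∈ interior A ↔ k < u y := by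
    refine fun y hy => ⟨fun h => ?_, fun h =>
      mem_interior_connectedComponentIn_of_lt hΩ hu.continuousOn ((hmem y hy).2 h.le) h⟩
    refine (hAS (interior_subset h)).2.lt_of_ne fun hky => hky.not_lt ?_
    exact (mem_interior_connectedComponentIn_iff hΩ hu.continuousOn
      (hreg y (hUΩ hy) hky.symm) (interior_subset h)).1 h
  refine ⟨U, fun y => k - u y, hUo, hpU, contDiffOn_const.sub (hu.mono hUΩ), ?_, ?_, ?_⟩
  · rw [fderiv_const_sub]
    exact neg_ne_zero.2 (hreg p (hAS hpA).1 hpk)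
  · ext y
    simp only [frontier, hclosed, mem_inter_iff, Set.mem_sdiff, mem_ofPred_eq, sub_eq_zero]
    refine ⟨fun ⟨⟨hyA, hyi⟩, hyU⟩ => ⟨hyU, ?_⟩, fun ⟨hyU, hy⟩ => ⟨⟨?_, ?_⟩, hyU⟩⟩
    · exact ((hmem y hyU).1 hyA).antisymm (not_lt.1 (mt (hint y hyU).2 hyi))
    · exact (hmem y hyU).2 hy.le
    · exact mt (hint y hyU).1 hy.not_lt
  · ext y
    simp only [mem_inter_iff, mem_ofPred_eq, sub_neg]
    exact ⟨fun ⟨hyi, hyU⟩ => ⟨hyU, (hint y hyU).1 hyi⟩, fun ⟨hyU, hy⟩ => ⟨(hint y hyU).2 hy, hyU⟩⟩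

end SuperlevelComponent

section RingMean

/-- Euclidean `n`-space. -/
abbrev Eucl (n : ℕ) : Type := EuclideanSpace ℝ (Fin n)

theorem nontrivial_eucl {n : ℕ} (hn : n ≠ 0) : Nontrivial (Eucl n) := by
  have : NeZero n := ⟨hn⟩
  infer_instance

/-- The ring `1/2 < |y| < 1`, over which the means of a Sobolev function are taken. -/
def unitRing (n : ℕ) : Set (Eucl n) := Metric.ball 0 1 \ Metric.closedBall 0 (1 / 2)

/-- The integral of `v` over the ring `a/2 < |z - x| < a`, rescaled to the unit ring (and not
divided by the volume of that ring). -/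
noncomputable def ringMean {n : ℕ} (v : Eucl n → ℝ) (x : Eucl n) (a : ℝ) : ℝ :=
  ∫ y in unitRing n, v (x + a • y)

/-- The constant in Hölder's inequality between `L¹` and `Lⁿ` on the unit ring. -/
noncomputable def ringConst (n : ℕ) : ℝ := volume.real (unitRing n) ^ (1 - 1 / (n : ℝ))

/-- `v` with the weak gradient `G` is a limit of smooth compactly supported functions in
`W^{1,n}`. -/
structure IsSobolevLimit {n : ℕ} (v : Eucl n → ℝ) (G : Eucl n → Eucl n) : Prop where
  memLp : MemLp v n volume
  memLp_grad : MemLp G n volume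
  exists_approx : ∀ ε : ℝ≥0∞, 0 < ε → ∃ φ : Eucl n → ℝ, ContDiff ℝ ∞ φ ∧ HasCompactSupport φ ∧
    eLpNorm (v - φ) n volume < ε ∧ eLpNorm (G - gradient φ) n volume < ε

/-- The Dirichlet energy `U ↦ ∫_U |G|^n` of a function with gradient `G`, as a measure. -/
noncomputable def energy {n : ℕ} (G : Eucl n → Eucl n) : Measure (Eucl n) :=
  volume.withDensity fun x => ‖G x‖ₑ ^ n

variable {n : ℕ}

theorem mem_unitRing {y : Eucl n} : y ∈ unitRing n ↔ 1 / 2 < ‖y‖ ∧ ‖y‖ < 1 := by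
  simp [unitRing, and_comm]

theorem isOpen_unitRing (n : ℕ) : IsOpen (unitRing n) :=
  Metric.isOpen_ball.sdiff Metric.isClosed_closedBall

theorem volume_unitRing_lt_top (n : ℕ) : volume (unitRing n) < ⊤ :=
  (measure_mono sdiff_subset).trans_lt measure_ball_lt_top

instance isFiniteMeasure_restrict_unitRing (n : ℕ) :
    IsFiniteMeasure (volume.restrict (unitRing n)) :=
  ⟨by rw [Measure.restrict_apply_univ]; exact volume_unitRing_lt_top n⟩

theorem volume_real_unitRing_pos (hn : n ≠ 0) : 0 < volume.real (unitRing n) := by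
  have := nontrivial_eucl hn
  obtain ⟨y, hy⟩ := exists_norm_eq (Eucl n) (c := 3 / 4) (by norm_num)
  refine ENNReal.toReal_pos ((isOpen_unitRing n).measure_pos volume ⟨y, ?_⟩).ne'
    (volume_unitRing_lt_top n).ne
  rw [mem_unitRing, hy]
  norm_num

theorem ringConst_nonneg (n : ℕ) : 0 ≤ ringConst n := Real.rpow_nonneg measureReal_nonneg _

section Gradient

variable {E : Type*} [NormedAddCommGroup E] [InnerProductSpace ℝ E] [CompleteSpace E] {φ : E → ℝ}

theorem continuous_gradient (hφ : ContDiff ℝ 1 φ) : Continuous (gradient φ) :=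
  (InnerProductSpace.toDual ℝ E).symm.continuous.comp (hφ.continuous_fderiv (by simp))

theorem norm_gradient (φ : E → ℝ) (x : E) : ‖gradient φ x‖ = ‖fderiv ℝ φ x‖ :=
  LinearIsometryEquiv.norm_map _ _

theorem hasCompactSupport_gradient (hφ : HasCompactSupport φ) : HasCompactSupport (gradient φ) :=
  (hφ.fderiv (𝕜 := ℝ)).comp_left (g := (InnerProductSpace.toDual ℝ E).symm) (map_zero _)

end Gradient

section AffineChange

variable {F : Type*} [NormedAddCommGroup F] {g : Eucl n → F} {b : ℝ}

theorem measurableEmbedding_affine (z : Eucl n) (hb : b ≠ 0) :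
    MeasurableEmbedding fun y : Eucl n => z + b • y :=
  ((Homeomorph.smulOfNeZero b hb).trans (Homeomorph.addLeft z)).measurableEmbedding

theorem map_affine (z : Eucl n) (hb : 0 < b) :
    Measure.map (fun y : Eucl n => z + b • y) volume = ENNReal.ofReal ((b ^ n)⁻¹) • volume := by
  have hcomp : (fun y : Eucl n => z + b • y) = (fun y => z + y) ∘ (fun y => b • y) := rfl
  rw [hcomp, ← Measure.map_map (measurable_const_add z) (measurable_const_smul b),
    Measure.map_addHaar_smul _ hb.ne', Measure.map_smul, map_add_left_eq_self,
    finrank_euclideanSpace_fin, abs_of_pos (by positivity)]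

theorem memLp_comp_affine {p : ℝ≥0∞} (hg : MemLp g p volume) (z : Eucl n) (hb : 0 < b) :
    MemLp (fun y => g (z + b • y)) p volume := by
  refine (measurableEmbedding_affine z hb.ne').memLp_map_measure_iff.1 ?_
  rw [map_affine z hb]
  exact hg.smul_measure ENNReal.ofReal_ne_top

theorem eLpNorm_comp_affine_le (hn : n ≠ 0) (g : Eucl n → F) (z : Eucl n) (hb : 0 < b)
    {D U : Set (Eucl n)} (hDU : MapsTo (fun y => z + b • y) D U) :
    eLpNorm (fun y => g (z + b • y)) n (volume.restrict D) ≤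
      ENNReal.ofReal b⁻¹ * eLpNorm g n (volume.restrict U) := by
  have hemb := measurableEmbedding_affine z hb.ne'
  have hscale : ENNReal.ofReal ((b ^ n)⁻¹) ^ (1 / (n : ℝ)) = ENNReal.ofReal b⁻¹ := by
    rw [ENNReal.ofReal_rpow_of_nonneg (by positivity) (by positivity), ← inv_pow, one_div,
      Real.pow_rpow_inv_natCast (by positivity) hn]
  calc eLpNorm (fun y => g (z + b • y)) n (volume.restrict D)
      ≤ eLpNorm (fun y => g (z + b • y)) n (volume.restrict ((fun y => z + b • y) ⁻¹' U)) :=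
        eLpNorm_mono_measure _ (Measure.restrict_mono hDU le_rfl)
    _ = eLpNorm g n ((ENNReal.ofReal ((b ^ n)⁻¹) • volume).restrict U) := by
        rw [← map_affine z hb, hemb.restrict_map, hemb.eLpNorm_map_measure]
        rfl
    _ = ENNReal.ofReal b⁻¹ * eLpNorm g n (volume.restrict U) := by
        rw [Measure.restrict_smul, eLpNorm_smul_measure_of_ne_top (by simp),
          ENNReal.toReal_div, ENNReal.toReal_one, ENNReal.toReal_natCast, hscale, smul_eq_mul]

theorem integrableOn_unitRing_comp_affine (hn : n ≠ 0) (hg : MemLp g n volume) (z : Eucl n)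
    (hb : 0 < b) : IntegrableOn (fun y => g (z + b • y)) (unitRing n) :=
  ((memLp_comp_affine hg z hb).restrict _).integrable
    (by exact_mod_cast Nat.one_le_iff_ne_zero.2 hn)

theorem integral_unitRing_norm_comp_affine_le (hn : n ≠ 0) (hg : MemLp g n volume) (z : Eucl n)
    (hb : 0 < b) {U : Set (Eucl n)} (hDU : MapsTo (fun y => z + b • y) (unitRing n) U) :
    ∫ y in unitRing n, ‖g (z + b • y)‖ ≤
      ringConst n * b⁻¹ * (eLpNorm g n (volume.restrict U)).toReal := by
  have hn1 : 1 ≤ n := Nat.one_le_iff_ne_zero.2 hn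
  have hmeas := ((memLp_comp_affine hg z hb).restrict (unitRing n)).1
  have hconst : (volume.restrict (unitRing n) univ) ^
      (1 / (1 : ℝ≥0∞).toReal - 1 / (n : ℝ≥0∞).toReal) = ENNReal.ofReal (ringConst n) := by
    have hexp : 0 ≤ 1 - 1 / (n : ℝ) := sub_nonneg.2 (div_le_one_of_le₀ (by exact_mod_cast hn1)
      (by positivity))
    rw [Measure.restrict_apply_univ, ringConst,
      ← ENNReal.ofReal_rpow_of_nonneg measureReal_nonneg hexp,
      ofReal_measureReal (volume_unitRing_lt_top n).ne]
    simp
  rw [integral_norm_eq_lintegral_enorm hmeas, ← eLpNorm_one_eq_lintegral_enorm]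
  refine ENNReal.toReal_le_of_le_ofReal (by have := ringConst_nonneg n; positivity) ?_
  calc eLpNorm (fun y => g (z + b • y)) 1 (volume.restrict (unitRing n))
      ≤ eLpNorm (fun y => g (z + b • y)) n (volume.restrict (unitRing n)) *
          ENNReal.ofReal (ringConst n) :=
        hconst ▸ eLpNorm_le_eLpNorm_mul_rpow_measure_univ (by exact_mod_cast hn1) hmeas
    _ ≤ ENNReal.ofReal b⁻¹ * eLpNorm g n (volume.restrict U) * ENNReal.ofReal (ringConst n) := by
        gcongr
        exact eLpNorm_comp_affine_le hn g z hb hDU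
    _ = ENNReal.ofReal (ringConst n * b⁻¹ * (eLpNorm g n (volume.restrict U)).toReal) := by
        rw [ENNReal.ofReal_mul (mul_nonneg (ringConst_nonneg n) (by positivity)),
          ENNReal.ofReal_mul (ringConst_nonneg n), ENNReal.ofReal_toReal (hg.restrict U).2.ne]
        ring

end AffineChange

section Lipschitz

variable {φ : Eucl n → ℝ} {x x' : Eucl n} {a a' : ℝ}

theorem norm_add_smul_le_of_mem_unitRing {y : Eucl n} (hy : y ∈ unitRing n) (w : Eucl n) (s : ℝ) :
    ‖w + s • y‖ ≤ ‖w‖ + |s| := by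
  refine (norm_add_le _ _).trans (add_le_add_right ?_ _)
  rw [norm_smul, Real.norm_eq_abs]
  exact mul_le_of_le_one_right (abs_nonneg _) (mem_unitRing.1 hy).2.le

theorem hasDerivAt_ringMean (hφ : ContDiff ℝ 1 φ) (hφc : HasCompactSupport φ) (x w : Eucl n)
    (a s t : ℝ) :
    HasDerivAt (fun t => ringMean φ (x + t • w) (a + t * s))
      (∫ y in unitRing n, fderiv ℝ φ (x + t • w + (a + t * s) • y) (w + s • y)) t := by
  have hγ (y : Eucl n) (t : ℝ) :
      HasDerivAt (fun t : ℝ => x + t • w + (a + t * s) • y) (w + s • y) t := by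
    have hx : HasDerivAt (fun t : ℝ => x + t • w) w t := by
      simpa using ((hasDerivAt_id t).smul_const w).const_add x
    have ha : HasDerivAt (fun t : ℝ => (a + t * s) • y) (s • y) t := by
      simpa using (((hasDerivAt_id t).mul_const s).const_add a).smul_const y
    exact hx.add ha
  have hφ' : Continuous (fderiv ℝ φ) := hφ.continuous_fderiv (by simp)
  obtain ⟨C, hC⟩ := hφ.continuous.bounded_above_of_compact_support hφc
  obtain ⟨M, hM⟩ := hφ'.bounded_above_of_compact_support (hφc.fderiv (𝕜 := ℝ))
  unfold ringMean
  refine (hasDerivAt_integral_of_dominated_loc_of_deriv_le (μ := volume.restrict (unitRing n))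
    (F := fun t y => φ (x + t • w + (a + t * s) • y))
    (F' := fun t y => fderiv ℝ φ (x + t • w + (a + t * s) • y) (w + s • y))
    (bound := fun _ => M * (‖w‖ + |s|)) (Filter.univ_mem (f := 𝓝 t))
    (Eventually.of_forall fun t => ?_) (.of_bound ?_ C (Eventually.of_forall fun y => hC _)) ?_ ?_
    (integrable_const _) (Eventually.of_forall fun y t _ => ?_)).2
  · exact (hφ.continuous.comp (by fun_prop)).aestronglyMeasurable
  · exact (hφ.continuous.comp (by fun_prop)).aestronglyMeasurable
  · exact ((hφ'.comp (by fun_prop)).clm_apply (by fun_prop)).aestronglyMeasurable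
  · refine ae_restrict_of_forall_mem (isOpen_unitRing n).measurableSet fun y hy t _ => ?_
    exact (ContinuousLinearMap.le_opNorm _ _).trans (mul_le_mul (hM _)
      (norm_add_smul_le_of_mem_unitRing hy w s) (norm_nonneg _) ((norm_nonneg _).trans (hM 0)))
  · exact (hφ.differentiable one_ne_zero).differentiableAt.hasFDerivAt.comp_hasDerivAt t (hγ y t)

theorem abs_ringMean_sub_le_of_integral_norm_gradient_le (hφ : ContDiff ℝ 1 φ)
    (hφc : HasCompactSupport φ) {K : ℝ}
    (hK : ∀ t ∈ Icc (0 : ℝ) 1,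
      ∫ y in unitRing n, ‖gradient φ (x + t • (x' - x) + (a + t * (a' - a)) • y)‖ ≤ K) :
    |ringMean φ x' a' - ringMean φ x a| ≤ (‖x' - x‖ + |a' - a|) * K := by
  set B : ℝ := ‖x' - x‖ + |a' - a|
  obtain ⟨M, hM⟩ := (continuous_gradient hφ).bounded_above_of_compact_support
    (hasCompactSupport_gradient hφc)
  have hderiv : ∀ t ∈ Ico (0 : ℝ) 1, ‖∫ y in unitRing n,
      fderiv ℝ φ (x + t • (x' - x) + (a + t * (a' - a)) • y) ((x' - x) + (a' - a) • y)‖ ≤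
      B * K := by
    refine fun t ht => le_trans ?_ (mul_le_mul_of_nonneg_left (hK t ⟨ht.1, ht.2.le⟩)
      (by positivity : 0 ≤ B))
    rw [← integral_const_mul]
    refine norm_integral_le_of_norm_le ?_
      (ae_restrict_of_forall_mem (isOpen_unitRing n).measurableSet fun y hy => ?_)
    · refine (Integrable.of_bound (C := M) ((continuous_gradient hφ).comp
        (by fun_prop)).norm.aestronglyMeasurable (Eventually.of_forall fun y => ?_)).const_mul B
      rw [norm_norm]
      exact hM _
    · rw [norm_gradient, mul_comm B]
      exact (ContinuousLinearMap.le_opNorm _ _).trans (mul_le_mul_of_nonneg_left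
        (norm_add_smul_le_of_mem_unitRing hy _ _) (norm_nonneg _))
  simpa using norm_image_sub_le_of_norm_deriv_le_segment_01'
    (fun t _ => (hasDerivAt_ringMean hφ hφc x (x' - x) a (a' - a) t).hasDerivWithinAt) hderiv

theorem abs_ringMean_sub_le_of_contDiff (hn : n ≠ 0) (hφ : ContDiff ℝ 1 φ)
    (hφc : HasCompactSupport φ) {b : ℝ} (hb : 0 < b) (ha : b ≤ a) (ha' : b ≤ a') {U : Set (Eucl n)}
    (hU : ∀ t ∈ Icc (0 : ℝ) 1,
      MapsTo (fun y => x + t • (x' - x) + (a + t * (a' - a)) • y) (unitRing n) U) :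
    |ringMean φ x' a' - ringMean φ x a| ≤ (‖x' - x‖ + |a' - a|) *
      (ringConst n * b⁻¹ * (eLpNorm (gradient φ) n (volume.restrict U)).toReal) := by
  refine abs_ringMean_sub_le_of_integral_norm_gradient_le hφ hφc fun t ht => ?_
  have hbt : b ≤ a + t * (a' - a) := by nlinarith [ht.1, ht.2]
  have hgrad : MemLp (gradient φ) n volume :=
    (continuous_gradient hφ).memLp_of_hasCompactSupport (hasCompactSupport_gradient hφc)
  refine (integral_unitRing_norm_comp_affine_le hn hgrad _ (hb.trans_le hbt) (hU t ht)).trans ?_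
  have := ringConst_nonneg n
  gcongr

theorem abs_ringMean_sub_ringMean_le (hn : n ≠ 0) {v w : Eucl n → ℝ} (hv : MemLp v n volume)
    (hw : MemLp w n volume) (x : Eucl n) (ha : 0 < a) :
    |ringMean v x a - ringMean w x a| ≤
      ringConst n * a⁻¹ * (eLpNorm (v - w) n volume).toReal := by
  rw [ringMean, ringMean, ← integral_sub (integrableOn_unitRing_comp_affine hn hv x ha)
    (integrableOn_unitRing_comp_affine hn hw x ha), ← Real.norm_eq_abs]
  refine (norm_integral_le_integral_norm _).trans ?_
  simpa using integral_unitRing_norm_comp_affine_le hn (hv.sub hw) x ha (mapsTo_univ _ _)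

end Lipschitz

section Energy

variable {G : Eucl n → Eucl n}

theorem isFiniteMeasure_energy (hn : n ≠ 0) (hG : MemLp G n volume) :
    IsFiniteMeasure (energy G) := by
  refine isFiniteMeasure_withDensity ?_
  simpa using (lintegral_rpow_enorm_lt_top_of_eLpNorm_lt_top (p := n) (by exact_mod_cast hn)
    (by simp) hG.2).ne

theorem toReal_eLpNorm_restrict (hn : n ≠ 0) (G : Eucl n → Eucl n) {U : Set (Eucl n)}
    (hU : MeasurableSet U) :
    (eLpNorm G n (volume.restrict U)).toReal = (energy G).real U ^ (1 / (n : ℝ)) := by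
  rw [eLpNorm_eq_lintegral_rpow_enorm_toReal (by exact_mod_cast hn) (by simp), energy,
    measureReal_def, withDensity_apply _ hU, ENNReal.toReal_rpow]
  simp

theorem toReal_eLpNorm_restrict_le_add {F : Type*} [NormedAddCommGroup F] {f g : Eucl n → F}
    {p : ℝ≥0∞} (hp : 1 ≤ p) (hf : MemLp f p volume) (hg : MemLp g p volume) (U : Set (Eucl n)) :
    (eLpNorm g p (volume.restrict U)).toReal ≤
      (eLpNorm f p (volume.restrict U)).toReal + (eLpNorm (f - g) p volume).toReal := by
  have htop := (hf.sub hg).2.ne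
  rw [← ENNReal.toReal_add (hf.restrict U).2.ne htop]
  refine ENNReal.toReal_mono (ENNReal.add_ne_top.2 ⟨(hf.restrict U).2.ne, htop⟩) ?_
  refine le_trans ?_ (add_le_add_right (eLpNorm_restrict_le (f - g) p volume U) _)
  simpa using eLpNorm_sub_le (hf.restrict U).1 ((hf.sub hg).restrict U).1 hp

theorem abs_ringMean_sub_le_energy (hn : n ≠ 0) {v : Eucl n → ℝ} (h : IsSobolevLimit v G)
    {x x' : Eucl n} {a a' b : ℝ} (hb : 0 < b) (ha : b ≤ a) (ha' : b ≤ a') {U : Set (Eucl n)}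
    (hU : MeasurableSet U) (hxU : ∀ t ∈ Icc (0 : ℝ) 1,
      MapsTo (fun y => x + t • (x' - x) + (a + t * (a' - a)) • y) (unitRing n) U) :
    |ringMean v x' a' - ringMean v x a| ≤
      ringConst n * ((‖x' - x‖ + |a' - a|) / b) * (energy G).real U ^ (1 / (n : ℝ)) := by
  rw [← toReal_eLpNorm_restrict hn G hU]
  have hC := ringConst_nonneg n
  set C := ringConst n
  set N := (eLpNorm G n (volume.restrict U)).toReal
  set B := ‖x' - x‖ + |a' - a|
  have : 0 ≤ B := by positivity
  have hbound : ∀ ε : ℝ, 0 < ε → |ringMean v x' a' - ringMean v x a| ≤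
      B * (C * b⁻¹ * (N + ε)) + 2 * (C * b⁻¹ * ε) := by
    intro ε hε
    obtain ⟨φ, hφ, hφc, hvφ, hGφ⟩ := h.exists_approx (ENNReal.ofReal ε) (by simpa using hε)
    have hφ1 : ContDiff ℝ 1 φ := hφ.of_le (by exact_mod_cast le_top)
    have hφL : MemLp φ n volume := hφ.continuous.memLp_of_hasCompactSupport hφc
    have hgL : MemLp (gradient φ) n volume :=
      (continuous_gradient hφ1).memLp_of_hasCompactSupport (hasCompactSupport_gradient hφc)
    have happrox : ∀ z : Eucl n, ∀ s ≥ b, |ringMean v z s - ringMean φ z s| ≤ C * b⁻¹ * ε := by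
      intro z s hs
      refine (abs_ringMean_sub_ringMean_le hn h.memLp hφL z (hb.trans_le hs)).trans ?_
      have := ENNReal.toReal_le_of_le_ofReal hε.le hvφ.le
      gcongr
    have hgrad : (eLpNorm (gradient φ) n (volume.restrict U)).toReal ≤ N + ε :=
      (toReal_eLpNorm_restrict_le_add (by exact_mod_cast Nat.one_le_iff_ne_zero.2 hn)
        h.memLp_grad hgL U).trans
        (add_le_add_right (ENNReal.toReal_le_of_le_ofReal hε.le hGφ.le) _)
    have hsmooth : |ringMean φ x' a' - ringMean φ x a| ≤ B * (C * b⁻¹ * (N + ε)) :=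
      (abs_ringMean_sub_le_of_contDiff hn hφ1 hφc hb ha ha' hxU).trans (by gcongr)
    have hx := abs_le.1 (happrox x a ha)
    have hx' := abs_le.1 (happrox x' a' ha')
    have hφx := abs_le.1 hsmooth
    exact abs_le.2 ⟨by linarith, by linarith⟩
  have hlim : Tendsto (fun ε => B * (C * b⁻¹ * (N + ε)) + 2 * (C * b⁻¹ * ε)) (𝓝[>] 0)
      (𝓝 (B * (C * b⁻¹ * (N + 0)) + 2 * (C * b⁻¹ * 0))) :=
    (Continuous.tendsto (by fun_prop) 0).mono_left nhdsWithin_le_nhds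
  refine (ge_of_tendsto hlim (eventually_mem_nhdsWithin.mono hbound)).trans_eq ?_
  ring

end Energy

end RingMean

section Pointwise

variable {n : ℕ} {v : Eucl n → ℝ} {G : Eucl n → Eucl n} {x : Eucl n}

theorem tendsto_ringMean (hn : n ≠ 0) (hv : MemLp v n volume) (hx : ContinuousAt v x) :
    Tendsto (ringMean v x) (𝓝[>] 0) (𝓝 (v x * volume.real (unitRing n))) := by
  rw [Metric.tendsto_nhds]
  intro ε hε
  set d := volume.real (unitRing n)
  have : 0 ≤ d := measureReal_nonneg
  obtain ⟨δ, hδ, hball⟩ := Metric.continuousAt_iff.1 hx (ε / (d + 1)) (by positivity)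
  filter_upwards [self_mem_nhdsWithin, mem_nhdsWithin_of_mem_nhds (Iio_mem_nhds hδ)]
    with a (ha : 0 < a) (haδ : a < δ)
  have hint : ringMean v x a - v x * d = ∫ y in unitRing n, (v (x + a • y) - v x) := by
    rw [integral_sub (integrableOn_unitRing_comp_affine hn hv x ha)
      (integrableOn_const (volume_unitRing_lt_top n).ne), setIntegral_const, ringMean, smul_eq_mul,
      mul_comm]
  rw [Real.dist_eq, hint, ← Real.norm_eq_abs]
  have hle : ‖∫ y in unitRing n, (v (x + a • y) - v x)‖ ≤ ε / (d + 1) * d := by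
    refine norm_setIntegral_le_of_norm_le_const (volume_unitRing_lt_top n) fun y hy => ?_
    refine (hball ?_).le
    rw [dist_eq_norm, add_sub_cancel_left, norm_smul, Real.norm_eq_abs, abs_of_pos ha]
    exact (mul_le_of_le_one_right ha.le (mem_unitRing.1 hy).2.le).trans_lt haδ
  refine hle.trans_lt ?_
  rw [div_mul_eq_mul_div, div_lt_iff₀ (by positivity)]
  nlinarith

theorem tendsto_mul_half_pow_add {R : ℝ} (hR : 0 < R) (K : ℕ) :
    Tendsto (fun N : ℕ => R * (1 / 2 : ℝ) ^ (K + N)) atTop (𝓝[>] 0) := by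
  refine tendsto_nhdsWithin_iff.2 ⟨?_, Eventually.of_forall fun N =>
    (by positivity : (0 : ℝ) < R * (1 / 2) ^ (K + N))⟩
  have hpow := (tendsto_pow_atTop_nhds_zero_of_lt_one (r := (1 / 2 : ℝ)) (by norm_num)
    (by norm_num)).const_mul (R * (1 / 2) ^ K)
  simpa only [mul_zero, pow_add, mul_assoc] using hpow

theorem sum_rpow_inv_le (hn : n ≠ 0) {ι : Type*} (t : Finset ι) {s : ι → ℝ}
    (hs : ∀ k ∈ t, 0 ≤ s k) :
    ∑ k ∈ t, s k ^ (1 / (n : ℝ)) ≤ ((t.card : ℝ) ^ (n - 1) * ∑ k ∈ t, s k) ^ (1 / (n : ℝ)) := by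
  obtain ⟨m, rfl⟩ := Nat.exists_eq_succ_of_ne_zero hn
  have hroot : ∀ k ∈ t, 0 ≤ s k ^ (1 / ((m + 1 : ℕ) : ℝ)) :=
    fun k hk => Real.rpow_nonneg (hs k hk) _
  have hpow : ∑ k ∈ t, (s k ^ (1 / ((m + 1 : ℕ) : ℝ))) ^ (m + 1) = ∑ k ∈ t, s k :=
    Finset.sum_congr rfl fun k hk => by rw [one_div, Real.rpow_inv_natCast_pow (hs k hk) hn]
  have hsum := pow_sum_le_card_mul_sum_pow hroot m
  rw [hpow] at hsum
  refine le_trans (le_of_eq ?_) (Real.rpow_le_rpow ?_ hsum (by positivity))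
  · rw [one_div, Real.pow_rpow_inv_natCast (by simpa using Finset.sum_nonneg hroot) hn]
  · exact pow_nonneg (Finset.sum_nonneg hroot) _

theorem sum_range_sub_add_two_le {f : ℕ → ℝ} (hf : Antitone f) (hf0 : ∀ k, 0 ≤ f k) (N : ℕ) :
    ∑ k ∈ Finset.range N, (f k - f (k + 2)) ≤ 2 * f 0 := by
  have htel : ∑ k ∈ Finset.range N, (f k - f (k + 2)) = f 0 + f 1 - f N - f (N + 1) := by
    induction N with
    | zero => simp
    | succ N ih => rw [Finset.sum_range_succ, ih]; ring
  linarith [hf zero_le_one, hf0 N, hf0 (N + 1)]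

/-- The sum of the geometric series of ratio `2 ^ (-1/n)`. -/
noncomputable def geomConst (n : ℕ) : ℝ := (1 - (1 / 2 : ℝ) ^ (1 / (n : ℝ)))⁻¹

theorem half_rpow_lt_one (hn : n ≠ 0) : (1 / 2 : ℝ) ^ (1 / (n : ℝ)) < 1 :=
  Real.rpow_lt_one (by norm_num) (by norm_num) (by positivity)

theorem geomConst_pos (hn : n ≠ 0) : 0 < geomConst n :=
  inv_pos.2 (sub_pos.2 (half_rpow_lt_one hn))

theorem sum_half_rpow_le (hn : n ≠ 0) (N : ℕ) :
    ∑ i ∈ Finset.range N, ((1 / 2 : ℝ) ^ i) ^ (1 / (n : ℝ)) ≤ geomConst n := by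
  have hratio : (0 : ℝ) ≤ (1 / 2 : ℝ) ^ (1 / (n : ℝ)) := by positivity
  have hpow (i : ℕ) : ((1 / 2 : ℝ) ^ i) ^ (1 / (n : ℝ)) = ((1 / 2 : ℝ) ^ (1 / (n : ℝ))) ^ i :=
    Real.rpow_pow_comm (by norm_num) _ _ |>.symm
  simp only [hpow]
  rw [geomConst, ← tsum_geometric_of_lt_one hratio (half_rpow_lt_one hn)]
  exact (summable_geometric_of_lt_one hratio (half_rpow_lt_one hn)).sum_le_tsum _
    fun i _ => pow_nonneg hratio i

/-- The energy of the ball `B(x, R / 2 ^ k)`. -/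
noncomputable def dyadicEnergy (G : Eucl n → Eucl n) (x : Eucl n) (R : ℝ) (k : ℕ) : ℝ :=
  (energy G).real (Metric.closedBall x (R * (1 / 2) ^ k))

theorem dyadicEnergy_nonneg (G : Eucl n → Eucl n) (x : Eucl n) (R : ℝ) (k : ℕ) :
    0 ≤ dyadicEnergy G x R k := measureReal_nonneg

theorem antitone_dyadicEnergy (hn : n ≠ 0) (hG : MemLp G n volume) (x : Eucl n) {R : ℝ}
    (hR : 0 ≤ R) : Antitone (dyadicEnergy G x R) := by
  have := isFiniteMeasure_energy hn hG
  exact fun k l hkl => measureReal_mono <| Metric.closedBall_subset_closedBall <|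
    mul_le_mul_of_nonneg_left (pow_le_pow_of_le_one (by norm_num) (by norm_num) hkl) hR

theorem abs_ringMean_half_sub_le (hn : n ≠ 0) (h : IsSobolevLimit v G) (x : Eucl n) {R : ℝ}
    (hR : 0 < R) (k : ℕ) :
    |ringMean v x (R * (1 / 2) ^ (k + 1)) - ringMean v x (R * (1 / 2) ^ k)| ≤
      ringConst n * (dyadicEnergy G x R k - dyadicEnergy G x R (k + 2)) ^ (1 / (n : ℝ)) := by
  have := isFiniteMeasure_energy hn h.memLp_grad
  have hclosed (r : ℝ) : MeasurableSet (Metric.closedBall x r) :=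
    Metric.isClosed_closedBall.measurableSet
  have hhalf : R * (1 / 2) ^ (k + 1) = R * (1 / 2) ^ k / 2 := by ring
  have hquarter : R * (1 / 2) ^ (k + 2) = R * (1 / 2) ^ k / 4 := by ring
  have ha : 0 < R * (1 / 2) ^ k := by positivity
  rw [dyadicEnergy, dyadicEnergy, hhalf, hquarter]
  set a := R * (1 / 2) ^ k
  rw [← measureReal_sdiff (Metric.closedBall_subset_closedBall (by linarith)) (hclosed _)]
  refine (abs_ringMean_sub_le_energy hn h (half_pos ha) (half_le_self ha.le) le_rfl
    ((hclosed a).diff (hclosed (a / 4))) fun t ht y hy => ?_).trans_eq ?_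
  · obtain ⟨hy1, hy2⟩ := mem_unitRing.1 hy
    have hlo : a / 2 ≤ a + t * (a / 2 - a) := by nlinarith [ht.1, ht.2]
    have hhi : a + t * (a / 2 - a) ≤ a := by nlinarith [ht.1, ht.2]
    have hdist : dist (x + t • (x - x) + (a + t * (a / 2 - a)) • y) x =
        (a + t * (a / 2 - a)) * ‖y‖ := by
      rw [sub_self, smul_zero, add_zero, dist_eq_norm, add_sub_cancel_left, norm_smul,
        Real.norm_eq_abs, abs_of_nonneg (by linarith)]
    rw [Set.mem_sdiff, Metric.mem_closedBall, Metric.mem_closedBall, hdist, not_le]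
    constructor <;> nlinarith
  · have hratio : (‖x - x‖ + |a / 2 - a|) / (a / 2) = 1 := by
      rw [sub_self, norm_zero, zero_add, abs_sub_comm, abs_of_pos (by linarith)]
      field_simp
      ring
    rw [hratio, mul_one]

theorem abs_ringMean_dyadic_le (hn : n ≠ 0) (h : IsSobolevLimit v G) {R η : ℝ} (hR : 0 < R)
    (hη : 0 ≤ η) {K : ℕ} (hK : ∀ k, dyadicEnergy G x R (K + k) ≤ η ^ n * (1 / 2) ^ k) (N : ℕ) :
    |ringMean v x (R * (1 / 2) ^ (K + N))| ≤ |ringMean v x R| + ringConst n *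
      (((K : ℝ) ^ (n - 1) * (2 * dyadicEnergy G x R 0)) ^ (1 / (n : ℝ)) + η * geomConst n) := by
  have hE0 := dyadicEnergy_nonneg G x R
  have hE := antitone_dyadicEnergy hn h.memLp_grad x hR.le
  set E := dyadicEnergy G x R
  have hdrop (k : ℕ) : 0 ≤ E k - E (k + 2) := sub_nonneg.2 (hE (by omega))
  have htele := dist_le_range_sum_of_dist_le (f := fun k => ringMean v x (R * (1 / 2) ^ k)) (K + N)
    fun {k} _ => (dist_comm _ _).trans_le (abs_ringMean_half_sub_le hn h x hR k)
  rw [← Finset.mul_sum, Finset.sum_range_add, pow_zero, mul_one, dist_comm, Real.dist_eq] at htele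
  have hcoarse : ∑ k ∈ Finset.range K, (E k - E (k + 2)) ^ (1 / (n : ℝ)) ≤
      ((K : ℝ) ^ (n - 1) * (2 * E 0)) ^ (1 / (n : ℝ)) := by
    refine (sum_rpow_inv_le hn _ fun k _ => hdrop k).trans ?_
    have hsum := sum_range_sub_add_two_le hE hE0 K
    have := Finset.sum_nonneg (s := Finset.range K) fun k _ => hdrop k
    rw [Finset.card_range]
    gcongr
  have hfine : ∑ k ∈ Finset.range N, (E (K + k) - E (K + k + 2)) ^ (1 / (n : ℝ)) ≤
      η * geomConst n := by
    refine le_trans (Finset.sum_le_sum fun k _ => ?_)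
      ((Finset.mul_sum _ _ _).symm.trans_le (mul_le_mul_of_nonneg_left (sum_half_rpow_le hn N) hη))
    have hle : E (K + k) - E (K + k + 2) ≤ η ^ n * (1 / 2) ^ k :=
      (sub_le_self _ (hE0 _)).trans (hK k)
    refine (Real.rpow_le_rpow (hdrop _) hle (by positivity)).trans_eq ?_
    rw [Real.mul_rpow (by positivity) (by positivity), one_div (n : ℝ),
      Real.pow_rpow_inv_natCast hη hn]
  have hsum := mul_le_mul_of_nonneg_left (add_le_add hcoarse hfine) (ringConst_nonneg n)
  linarith [abs_sub_abs_le_abs_sub (ringMean v x (R * (1 / 2) ^ (K + N))) (ringMean v x R)]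

theorem abs_mul_le_of_energy_decay (hn : n ≠ 0) (h : IsSobolevLimit v G) (hx : ContinuousAt v x)
    {R η : ℝ} (hR : 0 < R) (hη : 0 ≤ η) {K : ℕ}
    (hK : ∀ k, dyadicEnergy G x R (K + k) ≤ η ^ n * (1 / 2) ^ k) :
    |v x| * volume.real (unitRing n) ≤ |ringMean v x R| + ringConst n *
      (((K : ℝ) ^ (n - 1) * (2 * dyadicEnergy G x R 0)) ^ (1 / (n : ℝ)) + η * geomConst n) := by
  have hlim := ((tendsto_ringMean hn h.memLp hx).comp (tendsto_mul_half_pow_add hR K)).abs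
  rw [abs_mul, abs_of_nonneg (a := volume.real (unitRing n)) measureReal_nonneg] at hlim
  exact le_of_tendsto' hlim (abs_ringMean_dyadic_le hn h hR hη hK)

/-- The constant of the pointwise bound `abs_le_of_energy_decay`. -/
noncomputable def pointwiseConst (n : ℕ) (m : ℝ) : ℝ :=
  (m + ringConst n * (2 + geomConst n)) / volume.real (unitRing n)

theorem pointwiseConst_pos (hn : n ≠ 0) {m : ℝ} (hm : 0 ≤ m) : 0 < pointwiseConst n m := by
  have hd := volume_real_unitRing_pos hn
  have hC : 0 < ringConst n := Real.rpow_pos_of_pos hd _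
  have hS := geomConst_pos hn
  rw [pointwiseConst]
  positivity

/-- By Hölder, the first `K` dyadic scales contribute only `K ^ ((n - 1) / n)` times the energy. -/
theorem abs_le_of_energy_decay (hn : n ≠ 0) (h : IsSobolevLimit v G) (hx : ContinuousAt v x)
    {R η m : ℝ} (hR : 0 < R) (hη : 0 ≤ η) (hm : 0 ≤ m) (hmean : |ringMean v x R| ≤ m * η)
    (hball : dyadicEnergy G x R 0 ≤ η ^ n) {K : ℕ}
    (hK : ∀ k, dyadicEnergy G x R (K + k) ≤ η ^ n * (1 / 2) ^ k) :
    |v x| ≤ pointwiseConst n m * η * (((K : ℝ) + 1) ^ (n - 1)) ^ (1 / (n : ℝ)) := by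
  have hS := geomConst_pos hn
  have hC := ringConst_nonneg n
  set L : ℝ := (((K : ℝ) + 1) ^ (n - 1)) ^ (1 / (n : ℝ))
  have hL : 1 ≤ L := Real.one_le_rpow
    (one_le_pow₀ (by linarith [(Nat.cast_nonneg K : (0 : ℝ) ≤ K)])) (by positivity)
  have hE0 : 0 ≤ dyadicEnergy G x R 0 := dyadicEnergy_nonneg G x R 0
  have htwo : 2 * dyadicEnergy G x R 0 ≤ (2 * η) ^ n := by
    rw [mul_pow]
    exact mul_le_mul (le_self_pow₀ one_le_two hn) hball hE0 (by positivity)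
  have hcoarse : ((K : ℝ) ^ (n - 1) * (2 * dyadicEnergy G x R 0)) ^ (1 / (n : ℝ)) ≤
      L * (2 * η) :=
    calc ((K : ℝ) ^ (n - 1) * (2 * dyadicEnergy G x R 0)) ^ (1 / (n : ℝ))
        ≤ (((K : ℝ) + 1) ^ (n - 1) * (2 * η) ^ n) ^ (1 / (n : ℝ)) := by
          gcongr
          linarith
      _ = L * (2 * η) := by
          rw [Real.mul_rpow (by positivity) (by positivity), one_div (n : ℝ),
            Real.pow_rpow_inv_natCast (by positivity) hn, ← one_div]
  rw [pointwiseConst, div_mul_eq_mul_div, div_mul_eq_mul_div, le_div_iff₀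
    (volume_real_unitRing_pos hn)]
  calc |v x| * volume.real (unitRing n)
      ≤ m * η + ringConst n * (L * (2 * η) + η * geomConst n) :=
        (abs_mul_le_of_energy_decay hn h hx hR hη hK).trans (by gcongr)
    _ ≤ m * η * L + ringConst n * (L * (2 * η) + η * geomConst n * L) :=
        add_le_add (le_mul_of_one_le_right (by positivity) hL) (mul_le_mul_of_nonneg_left
          (add_le_add_right (le_mul_of_one_le_right (by positivity) hL) _) hC)
    _ = (m + ringConst n * (2 + geomConst n)) * η * L := by ring

end Pointwise

section Covering

theorem outerMeasure_le_of_closedBall_le {X : Type*} [PseudoMetricSpace X]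
    [TopologicalSpace.SeparableSpace X]
    [MeasurableSpace X] [OpensMeasurableSpace X] (m : OuterMeasure X) (ν : Measure X)
    {S U : Set X} {ρ : X → ℝ} {R : ℝ} {c : ℝ≥0∞} (hρ : ∀ x ∈ S, 0 < ρ x) (hρR : ∀ x ∈ S, ρ x ≤ R)
    (hU : ∀ x ∈ S, Metric.closedBall x (ρ x) ⊆ U)
    (hm : ∀ x ∈ S, m (Metric.closedBall x (5 * ρ x)) ≤ c * ν (Metric.closedBall x (ρ x))) :
    m S ≤ c * ν U := by
  obtain ⟨T, hTS, hTd, hTc⟩ := Vitali.exists_disjoint_subfamily_covering_enlargement_closedBall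
    S id ρ R hρR 5 (by norm_num)
  have hcount : T.Countable := hTd.countable_of_nonempty_interior fun x hx =>
    ⟨x, Metric.ball_subset_interior_closedBall (Metric.mem_ball_self (hρ x (hTS hx)))⟩
  calc m S ≤ m (⋃ x ∈ T, Metric.closedBall x (5 * ρ x)) := by
        refine measure_mono fun x hx => ?_
        obtain ⟨y, hy, hxy⟩ := hTc x hx
        exact mem_iUnion₂.2 ⟨y, hy, hxy (Metric.mem_closedBall_self (hρ x hx).le)⟩
    _ ≤ ∑' x : T, m (Metric.closedBall (x : X) (5 * ρ x)) :=
        measure_biUnion_le m hcount _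
    _ ≤ ∑' x : T, c * ν (Metric.closedBall (x : X) (ρ x)) :=
        ENNReal.tsum_le_tsum fun x => hm x (hTS x.2)
    _ = c * ν (⋃ x ∈ T, Metric.closedBall x (ρ x)) := by
        rw [ENNReal.tsum_mul_left]
        exact congrArg (c * ·) (measure_biUnion hcount hTd
          fun x _ => Metric.isClosed_closedBall.measurableSet).symm
    _ ≤ c * ν U := by
        gcongr
        exact iUnion₂_subset fun x hx => hU x (hTS hx)

variable {n : ℕ} {v : Eucl n → ℝ} {G : Eucl n → Eucl n} {S U : Set (Eucl n)} {R : ℝ}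

theorem mul_half_pow_le (hR : 0 ≤ R) (k : ℕ) : R * (1 / 2) ^ k ≤ R :=
  mul_le_of_le_one_right hR (pow_le_one₀ (by norm_num) (by norm_num))

/-- A smallness threshold: where the mean and, at every dyadic scale, the energy are controlled by
it, `|v|` is at most `1 / 2`. -/
noncomputable def smallConst (n : ℕ) : ℝ := (2 * pointwiseConst n 1)⁻¹

theorem smallConst_pos (hn : n ≠ 0) : 0 < smallConst n :=
  inv_pos.2 (mul_pos two_pos (pointwiseConst_pos hn zero_le_one))

theorem exists_energy_gt_of_half_lt_abs (hn : n ≠ 0) (h : IsSobolevLimit v G) {x : Eucl n}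
    (hx : ContinuousAt v x) (hR : 0 < R) (hmean : |ringMean v x R| ≤ smallConst n)
    (hv : 1 / 2 < |v x|) : ∃ k, smallConst n ^ n * (1 / 2) ^ k < dyadicEnergy G x R k := by
  by_contra! hdecay
  refine hv.not_ge ?_
  have hle := abs_le_of_energy_decay hn h hx hR (smallConst_pos hn).le zero_le_one
    (by rwa [one_mul]) (by simpa using hdecay 0) (K := 0) (by simpa only [zero_add] using hdecay)
  have hP := pointwiseConst_pos hn zero_le_one
  refine hle.trans_eq ?_
  rw [Nat.cast_zero, zero_add, one_pow, Real.one_rpow, smallConst]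
  field_simp

theorem volume_image_le_energy (hn : n ≠ 0) (h : IsSobolevLimit v G) (hR : 0 < R)
    (hS : ∀ x ∈ S, ContinuousAt v x ∧ 1 / 2 < |v x| ∧ |ringMean v x R| ≤ smallConst n ∧
      Metric.closedBall x R ⊆ U) {f : Eucl n → ℝ} (hf : LipschitzWith 1 f) :
    volume (f '' S) ≤ ENNReal.ofReal (10 / smallConst n ^ n * R) * energy G U := by
  have := isFiniteMeasure_energy hn h.memLp_grad
  have hq := smallConst_pos hn
  choose! k hk using fun x hx => exists_energy_gt_of_half_lt_abs hn h (hS x hx).1 hR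
    (hS x hx).2.2.1 (hS x hx).2.1
  refine outerMeasure_le_of_closedBall_le
    (OuterMeasure.comap f (volume : Measure ℝ).toOuterMeasure) (energy G)
    (ρ := fun x => R * (1 / 2) ^ k x) (fun x _ => by positivity)
    (fun x _ => mul_half_pow_le hR.le _) (fun x hx => (Metric.closedBall_subset_closedBall
      (mul_half_pow_le hR.le _)).trans (hS x hx).2.2.2) fun x hx => ?_
  set ρ := R * (1 / 2 : ℝ) ^ k x with hρ
  rw [OuterMeasure.comap_apply, ← ofReal_measureReal (μ := energy G),
    ← ENNReal.ofReal_mul (by positivity)]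
  calc volume (f '' Metric.closedBall x (5 * ρ)) ≤ volume (Metric.closedBall (f x) (5 * ρ)) := by
        refine measure_mono (mapsTo_iff_image_subset.1 ?_)
        simpa using hf.mapsTo_closedBall x (5 * ρ)
    _ = ENNReal.ofReal (10 / smallConst n ^ n * R * (smallConst n ^ n * (1 / 2) ^ k x)) := by
        rw [Real.volume_closedBall, hρ]
        congr 1
        field_simp
        ring
    _ ≤ _ := by
        gcongr
        exact (hk x hx).le

theorem volume_superlevel_le (hn : n ≠ 0) (h : IsSobolevLimit v G) {m η : ℝ} (hR : 0 < R)
    (hm : 0 ≤ m) (hη : 0 < η) (hU : (energy G).real U ≤ η ^ n)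
    (hS : ∀ x ∈ S, ContinuousAt v x ∧ |ringMean v x R| ≤ m * η ∧ Metric.closedBall x R ⊆ U)
    (K : ℕ) :
    volume {x ∈ S | pointwiseConst n m * η * (((K : ℝ) + 1) ^ (n - 1)) ^ (1 / (n : ℝ)) < |v x|} ≤
      ENNReal.ofReal ((5 * R) ^ n * volume.real (Metric.ball (0 : Eucl n) 1) * (1 / 2) ^ K) := by
  have := isFiniteMeasure_energy hn h.memLp_grad
  set V := volume.real (Metric.ball (0 : Eucl n) 1)
  have : 0 ≤ V := measureReal_nonneg
  set T := {x ∈ S | pointwiseConst n m * η * (((K : ℝ) + 1) ^ (n - 1)) ^ (1 / (n : ℝ)) < |v x|}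
  have hdense : ∀ x ∈ T, ∃ k, η ^ n * (1 / 2) ^ k < dyadicEnergy G x R (K + k) := by
    intro x hx
    obtain ⟨hcont, hmean, hball⟩ := hS x hx.1
    by_contra! hdecay
    exact hx.2.not_ge (abs_le_of_energy_decay hn h hcont hR hη.le hm hmean
      ((measureReal_mono (by simpa using hball)).trans hU) hdecay)
  choose! k hk using hdense
  refine (outerMeasure_le_of_closedBall_le volume.toOuterMeasure (energy G) (U := U)
    (ρ := fun x => R * (1 / 2) ^ (K + k x))
    (c := ENNReal.ofReal ((5 * R) ^ n * V * (1 / 2) ^ K / η ^ n)) (fun x _ => by positivity)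
    (fun x _ => mul_half_pow_le hR.le _) (fun x hx => (Metric.closedBall_subset_closedBall
      (mul_half_pow_le hR.le _)).trans (hS x hx.1).2.2) fun x hx => ?_).trans ?_
  · rw [Measure.coe_toOuterMeasure, Measure.addHaar_closedBall _ _ (by positivity),
      finrank_euclideanSpace_fin,
      ← ofReal_measureReal (μ := energy G), ← ENNReal.ofReal_mul (by positivity),
      ← ofReal_measureReal (μ := volume) (s := Metric.ball (0 : Eucl n) 1)
        measure_ball_lt_top.ne, ← ENNReal.ofReal_mul (by positivity)]
    refine ENNReal.ofReal_le_ofReal ?_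
    have hpow : ((1 / 2 : ℝ) ^ (K + k x)) ^ n ≤ (1 / 2) ^ (K + k x) :=
      pow_le_of_le_one (by positivity) (pow_le_one₀ (by norm_num) (by norm_num)) hn
    calc (5 * (R * (1 / 2) ^ (K + k x))) ^ n * V
        = (5 * R) ^ n * V * ((1 / 2 : ℝ) ^ (K + k x)) ^ n := by
          rw [← mul_assoc, mul_pow (5 * R)]; ring
      _ ≤ (5 * R) ^ n * V * (1 / 2) ^ (K + k x) := by gcongr
      _ = (5 * R) ^ n * V * (1 / 2) ^ K / η ^ n * (η ^ n * (1 / 2) ^ k x) := by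
          rw [pow_add]; field_simp
      _ ≤ _ := mul_le_mul_of_nonneg_left (hk x hx).le (by positivity)
  · rw [← ofReal_measureReal (μ := energy G) (s := U), ← ENNReal.ofReal_mul (by positivity)]
    refine ENNReal.ofReal_le_ofReal ?_
    rw [div_mul_eq_mul_div, div_le_iff₀ (by positivity)]
    gcongr

end Covering

section ZeroExtension

theorem gradient_eq_zero_of_notMem_tsupport {E : Type*} [NormedAddCommGroup E]
    [InnerProductSpace ℝ E] [CompleteSpace E] {φ : E → ℝ} {x : E} (hx : x ∉ tsupport φ) :
    gradient φ x = 0 := by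
  rw [← norm_eq_zero, norm_gradient, fderiv_of_notMem_tsupport ℝ hx, norm_zero]

theorem eLpNorm_indicator_sub {X F : Type*} [MeasurableSpace X] [NormedAddCommGroup F]
    {μ : Measure X} {Ω : Set X} (hΩ : MeasurableSet Ω) (f : X → F) {g : X → F}
    (hg : ∀ x ∉ Ω, g x = 0) (p : ℝ≥0∞) :
    eLpNorm (Ω.indicator f - g) p μ = eLpNorm (fun x => f x - g x) p (μ.restrict Ω) := by
  rw [← eLpNorm_indicator_eq_eLpNorm_restrict hΩ]
  congr 1
  ext1 x
  by_cases hx : x ∈ Ω <;> simp [hx, hg]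

theorem continuousAt_indicator_of_mem {X Y : Type*} [TopologicalSpace X] [TopologicalSpace Y]
    [Zero Y] {Ω : Set X} (hΩ : IsOpen Ω) {u : X → Y} (hu : ContinuousOn u Ω) {x : X}
    (hx : x ∈ Ω) : ContinuousAt (Ω.indicator u) x :=
  (hu.continuousAt (hΩ.mem_nhds hx)).congr
    (eqOn_indicator.symm.eventuallyEq_of_mem (hΩ.mem_nhds hx))

variable {n : ℕ} {Ω A U : Set (Eucl n)} {u v : Eucl n → ℝ} {G : Eucl n → Eucl n} {p x : Eucl n}

theorem MemW1n0.isSobolevLimit (hΩ : IsOpen Ω) (hu : MemW1n0 Ω u) :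
    IsSobolevLimit (Ω.indicator u) (Ω.indicator (weakGrad Ω u)) where
  memLp := (memLp_indicator_iff_restrict hΩ.measurableSet).2 hu.1.2.1
  memLp_grad := (memLp_indicator_iff_restrict hΩ.measurableSet).2 hu.1.2.2
  exists_approx ε hε := by
    obtain ⟨φ, ⟨hφ, hφc, hφΩ⟩, hle, hle'⟩ := hu.2 ε hε
    refine ⟨φ, hφ, hφc, ?_, ?_⟩
    · rwa [eLpNorm_indicator_sub hΩ.measurableSet u fun x hx =>
        image_eq_zero_of_notMem_tsupport fun h => hx (hφΩ h)]
    · rwa [eLpNorm_indicator_sub hΩ.measurableSet (weakGrad Ω u) fun x hx =>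
        gradient_eq_zero_of_notMem_tsupport fun h => hx (hφΩ h)]

theorem energy_indicator_apply (hn : n ≠ 0) (hΩ : MeasurableSet Ω) (hU : MeasurableSet U)
    (G : Eucl n → Eucl n) : energy (Ω.indicator G) U = ∫⁻ x in Ω ∩ U, ‖G x‖ₑ ^ n := by
  rw [energy, withDensity_apply _ hU, ← setLIntegral_indicator hΩ]
  refine lintegral_congr fun x => ?_
  by_cases hx : x ∈ Ω <;> simp [hx, hn]

theorem ringMean_eq_zero {a : ℝ} (ha : 0 < a) (hv : ∀ y ∈ Metric.ball x a, v y = 0) :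
    ringMean v x a = 0 := by
  refine setIntegral_eq_zero_of_forall_eq_zero fun y hy => hv _ ?_
  rw [Metric.mem_ball, dist_eq_norm, add_sub_cancel_left, norm_smul, Real.norm_eq_abs,
    abs_of_pos ha]
  exact mul_lt_of_lt_one_right ha (mem_unitRing.1 hy).2

/-- The distances from `p` to the points of `A` fill `(a, b)`, so the covering by balls of high
energy bounds `b - a`. -/
theorem sub_le_mul_energy_of_isPreconnected (hn : n ≠ 0) (h : IsSobolevLimit v G) {R : ℝ}
    (hR : 0 < R) (hA : IsPreconnected A) {x y : Eucl n} (hx : x ∈ A) (hy : y ∈ A) {a b : ℝ}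
    (hxa : dist x p ≤ a) (hyb : b ≤ dist y p)
    (hS : ∀ z ∈ A, dist z p ∈ Ioo a b → ContinuousAt v z ∧ 1 / 2 < |v z| ∧
      |ringMean v z R| ≤ smallConst n ∧ Metric.closedBall z R ⊆ U) :
    b - a ≤ 10 / smallConst n ^ n * R * (energy G).real U := by
  have := isFiniteMeasure_energy hn h.memLp_grad
  have hq := smallConst_pos hn
  have hcross : Ioo a b ⊆ (dist · p) '' {z ∈ A | dist z p ∈ Ioo a b} := by
    intro s hs
    obtain ⟨z, hz, rfl⟩ := hA.intermediate_value hx hy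
      (continuous_id.dist continuous_const).continuousOn ⟨hxa.trans hs.1.le, hs.2.le.trans hyb⟩
    exact ⟨z, ⟨hz, hs⟩, rfl⟩
  have hvol := (measure_mono hcross).trans
    (volume_image_le_energy hn h hR (fun z hz => hS z hz.1 hz.2) (LipschitzWith.dist_left p))
  rw [Real.volume_Ioo, ← ofReal_measureReal (μ := energy G),
    ← ENNReal.ofReal_mul (by positivity)] at hvol
  exact (ENNReal.ofReal_le_ofReal_iff (by positivity)).1 hvol

section Boundary

variable {E : Type*} [NormedAddCommGroup E] [NormedSpace ℝ E]

theorem exists_norm_le_one_apply_pos {L : E →L[ℝ] ℝ} (hL : L ≠ 0) : ∃ e, ‖e‖ ≤ 1 ∧ 0 < L e := by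
  obtain ⟨w, hw⟩ : ∃ w, 0 < L w := by
    by_contra! hle
    refine hL (ContinuousLinearMap.ext fun w => (hle w).antisymm ?_)
    simpa using hle (-w)
  have hw0 : w ≠ 0 := fun h => by simp [h] at hw
  refine ⟨‖w‖⁻¹ • w, (norm_smul_inv_norm (𝕜 := ℝ) hw0).le, ?_⟩
  rw [map_smul, smul_eq_mul]
  positivity

theorem exists_cone_lt_of_hasFDerivAt {ψ : E → ℝ} {L : E →L[ℝ] ℝ} {p e : E} (hψ : HasFDerivAt ψ L p)
    (he : ‖e‖ ≤ 1) (hLe : 0 < L e) :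
    ∃ c : ℝ, 0 < c ∧ c ≤ 1 ∧ ∀ᶠ ρ in 𝓝[>] (0 : ℝ), ∀ y ∈ Metric.ball (p + ρ • e) (c * ρ),
      ψ p < ψ y := by
  obtain ⟨δ, hδ, hball⟩ := Metric.eventually_nhds_iff.1 (hψ.isLittleO.def (c := L e / 4)
    (by positivity))
  set c := min 1 (L e / (4 * (‖L‖ + 1)))
  have hc0 : 0 < c := lt_min one_pos (by positivity)
  have hc1 : c ≤ 1 := min_le_left _ _
  have hcL : ‖L‖ * c ≤ L e / 4 := by
    have := (le_div_iff₀ (by positivity)).1 (min_le_right 1 (L e / (4 * (‖L‖ + 1))))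
    nlinarith
  refine ⟨c, hc0, hc1, ?_⟩
  filter_upwards [self_mem_nhdsWithin, mem_nhdsWithin_of_mem_nhds (Iio_mem_nhds (half_pos hδ))]
    with ρ (hρ : 0 < ρ) (hρδ : ρ < δ / 2) y hy
  rw [Metric.mem_ball, dist_eq_norm] at hy
  set z := y - (p + ρ • e)
  have hyp : y - p = ρ • e + z := by simp only [z]; abel
  have hnorm : ‖y - p‖ ≤ 2 * ρ := by
    rw [hyp]
    refine (norm_add_le _ _).trans ?_
    rw [norm_smul, Real.norm_eq_abs, abs_of_pos hρ]
    nlinarith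
  have hlin := hball (by rw [dist_eq_norm]; linarith)
  rw [Real.norm_eq_abs, hyp, map_add, map_smul, smul_eq_mul, ← hyp] at hlin
  have hLz : |L z| ≤ ‖L‖ * (c * ρ) := (L.le_opNorm z).trans (by gcongr)
  nlinarith [(abs_le.1 hlin).1, (abs_le.1 hLz).1]

end Boundary

theorem HasSmoothBoundary.exists_exterior_ball (hΩ : IsOpen Ω) (hs : HasSmoothBoundary Ω)
    (hp : p ∈ frontier Ω) :
    ∃ (e : Eucl n) (c : ℝ), 0 < c ∧ c ≤ 1 ∧ ‖e‖ ≤ 1 ∧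
      ∀ᶠ ρ in 𝓝[>] (0 : ℝ), Metric.ball (p + ρ • e) (c * ρ) ⊆ Ωᶜ := by
  obtain ⟨U, ψ, hU, hpU, hψ, hne, hfrontier, hinterior⟩ := hs p hp
  obtain ⟨e, he, hLe⟩ := exists_norm_le_one_apply_pos hne
  have hψp : ψ p = 0 := (hfrontier.subset ⟨hp, hpU⟩).2
  obtain ⟨c, hc, hc1, hcone⟩ := exists_cone_lt_of_hasFDerivAt
    ((hψ.contDiffAt (hU.mem_nhds hpU)).differentiableAt (by simp)).hasFDerivAt he hLe
  obtain ⟨δ, hδ, hδU⟩ := Metric.isOpen_iff.1 hU p hpU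
  refine ⟨e, c, hc, hc1, he, ?_⟩
  filter_upwards [self_mem_nhdsWithin, mem_nhdsWithin_of_mem_nhds (Iio_mem_nhds (half_pos hδ)),
    hcone] with ρ (hρ : 0 < ρ) (hρδ : ρ < δ / 2) hpos y hy hyΩ
  have hyU : y ∈ U := by
    refine hδU (Metric.ball_subset_ball' ?_ hy)
    rw [dist_eq_norm, add_sub_cancel_left, norm_smul, Real.norm_eq_abs, abs_of_pos hρ]
    nlinarith
  have hneg : ψ y < 0 := (hinterior.subset ⟨hΩ.interior_eq.symm ▸ hyΩ, hyU⟩).2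
  exact (hψp ▸ hpos y hy).not_gt hneg

theorem tendsto_energy_closedBall (hn : n ≠ 0) (hG : MemLp G n volume) (p : Eucl n) :
    Tendsto (fun ρ => (energy G).real (Metric.closedBall p ρ)) (𝓝[>] 0) (𝓝 0) := by
  have := isFiniteMeasure_energy hn hG
  have := nontrivial_eucl hn
  have hpoint : energy G {p} = 0 := withDensity_absolutelyContinuous _ _ (measure_singleton p)
  have hlim := tendsto_measure_cthickening (μ := energy G) (s := {p})
    ⟨1, one_pos, (measure_lt_top _ _).ne⟩
  rw [closure_singleton, hpoint] at hlim
  refine ((ENNReal.tendsto_toReal ENNReal.zero_ne_top).comp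
    (hlim.mono_left (nhdsWithin_le_nhds (s := Ioi 0)))).congr' ?_
  filter_upwards [self_mem_nhdsWithin] with ρ (hρ : 0 < ρ)
  simp only [Function.comp, Metric.cthickening_singleton p hρ.le, measureReal_def]

theorem mapsTo_segment_of_convex {E : Type*} [AddCommGroup E] [Module ℝ E] {D U : Set E}
    (hU : Convex ℝ U) {x x' : E} {a a' : ℝ} (h : MapsTo (fun y => x + a • y) D U)
    (h' : MapsTo (fun y => x' + a' • y) D U) {t : ℝ} (ht : t ∈ Icc (0 : ℝ) 1) :
    MapsTo (fun y => x + t • (x' - x) + (a + t * (a' - a)) • y) D U := by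
  intro y hy
  convert hU.add_smul_sub_mem (h hy) (h' hy) ht using 1
  module

theorem add_smul_mem_closedBall_of_mem_unitRing {x p y : Eucl n} {a r : ℝ} (ha : 0 ≤ a)
    (hr : dist x p + a ≤ r) (hy : y ∈ unitRing n) : x + a • y ∈ Metric.closedBall p r := by
  refine Metric.closedBall_subset_closedBall' (by linarith : a + dist x p ≤ r) ?_
  rw [mem_closedBall_iff_norm, add_sub_cancel_left, norm_smul, Real.norm_eq_abs, abs_of_nonneg ha]
  exact mul_le_of_le_one_right ha (mem_unitRing.1 hy).2.le

theorem abs_ringMean_le_of_eq_zero_on_ball (hn : n ≠ 0) (h : IsSobolevLimit v G) {e : Eucl n}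
    {c ρ : ℝ} (hc : 0 < c) (hc1 : c ≤ 1) (hρ : 0 < ρ) (he : ‖e‖ ≤ 1)
    (hv : ∀ y ∈ Metric.ball (p + ρ • e) (c * ρ), v y = 0) (hx : dist x p ≤ 2 * ρ) :
    |ringMean v x ρ| ≤ ringConst n * (4 / c) *
      (energy G).real (Metric.closedBall p (3 * ρ)) ^ (1 / (n : ℝ)) := by
  have hcρ : 0 < c * ρ := by positivity
  have hcρ' : c * ρ ≤ ρ := mul_le_of_le_one_left hρ.le hc1
  have hep : dist (p + ρ • e) p ≤ ρ := by
    rw [dist_eq_norm, add_sub_cancel_left, norm_smul, Real.norm_eq_abs, abs_of_pos hρ]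
    exact mul_le_of_le_one_right hρ.le he
  have hle := abs_ringMean_sub_le_energy hn h (x := x) (x' := p + ρ • e) hcρ hcρ' le_rfl
    (U := Metric.closedBall p (3 * ρ)) Metric.isClosed_closedBall.measurableSet
    fun t ht => mapsTo_segment_of_convex (convex_closedBall p (3 * ρ))
      (fun y hy => add_smul_mem_closedBall_of_mem_unitRing hρ.le (by linarith) hy)
      (fun y hy => add_smul_mem_closedBall_of_mem_unitRing hcρ.le (by linarith) hy) ht
  rw [ringMean_eq_zero hcρ hv, zero_sub, abs_neg] at hle
  refine hle.trans ?_
  have := ringConst_nonneg n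
  gcongr ringConst n * ?_ * _
  rw [div_le_div_iff₀ hcρ hc, abs_of_nonpos (by linarith), ← dist_eq_norm]
  nlinarith [dist_triangle_right (p + ρ • e) x p]

theorem mul_rpow_one_div_le (hn : n ≠ 0) {m q E : ℝ} (hm : 0 ≤ m) (hq : 0 ≤ q) (hE : 0 ≤ E)
    (hEq : E ≤ (q / (m + 1)) ^ n) : m * E ^ (1 / (n : ℝ)) ≤ q := by
  have hroot := Real.rpow_le_rpow hE hEq (by positivity : 0 ≤ 1 / (n : ℝ))
  rw [one_div (n : ℝ), Real.pow_rpow_inv_natCast (by positivity) hn, ← one_div (n : ℝ)] at hroot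
  calc m * E ^ (1 / (n : ℝ)) ≤ m * (q / (m + 1)) := by gcongr
    _ ≤ q := by
      rw [mul_div_assoc', div_le_iff₀ (by positivity)]
      nlinarith

theorem closure_subset_of_isPreconnected (hn : n ≠ 0) (hΩ : IsOpen Ω) (hs : HasSmoothBoundary Ω)
    (hu : MemW1n0 Ω u) (huc : ContinuousOn u Ω) (hA : IsPreconnected A) (hAΩ : A ⊆ Ω)
    (hAu : ∀ x ∈ A, 1 / 2 < |u x|) : closure A ⊆ Ω := by
  intro p hp
  by_contra hpΩ
  have h := hu.isSobolevLimit hΩ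
  set v := Ω.indicator u
  set G := Ω.indicator (weakGrad Ω u)
  have hq := smallConst_pos hn
  obtain ⟨e, c, hc, hc1, he, hext⟩ := hs.exists_exterior_ball hΩ
    (hΩ.frontier_eq ▸ ⟨closure_mono hAΩ hp, hpΩ⟩ : p ∈ frontier Ω)
  obtain ⟨y, hy⟩ : A.Nonempty := closure_nonempty_iff.1 ⟨p, hp⟩
  have hyp : 0 < dist y p := dist_pos.2 fun hyp => hpΩ (hyp ▸ hAΩ hy)
  have hE : Tendsto (fun ρ => (energy G).real (Metric.closedBall p (3 * ρ))) (𝓝[>] 0) (𝓝 0) :=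
    (tendsto_energy_closedBall hn h.memLp_grad p).comp <| tendsto_nhdsWithin_iff.2
      ⟨((continuous_const_mul (3 : ℝ)).tendsto' 0 0 (mul_zero 3)).mono_left nhdsWithin_le_nhds,
        eventually_mem_nhdsWithin.mono fun ρ (hρ : 0 < ρ) => mem_Ioi.2 (by positivity)⟩
  have hm : 0 ≤ ringConst n * (4 / c) := mul_nonneg (ringConst_nonneg n) (by positivity)
  obtain ⟨ρ, (hρ : 0 < ρ), hρy, hρext, hρE⟩ := (eventually_mem_nhdsWithin.and
    ((eventually_nhdsWithin_of_eventually_nhds (eventually_lt_nhds (half_pos hyp))).and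
    (hext.and (hE.eventually_lt_const (by positivity : 0 < min (smallConst n ^ n / 10)
      ((smallConst n / (ringConst n * (4 / c) + 1)) ^ n)))))).exists
  have hρmean := mul_rpow_one_div_le hn hm hq.le measureReal_nonneg
    (hρE.le.trans (min_le_right _ _))
  obtain ⟨x, hx, hxA⟩ := mem_closure_iff_nhds.1 hp _ (Metric.ball_mem_nhds p hρ)
  have hcross := sub_le_mul_energy_of_isPreconnected hn h hρ hA hxA hy (Metric.mem_ball.1 hx).le
    (by linarith : 2 * ρ ≤ dist y p) (U := Metric.closedBall p (3 * ρ)) fun z hzA hz =>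
      ⟨continuousAt_indicator_of_mem hΩ huc (hAΩ hzA), by
        simpa only [v, indicator_of_mem (hAΩ hzA)] using hAu z hzA,
        (abs_ringMean_le_of_eq_zero_on_ball hn h hc hc1 hρ he
          (fun w hw => indicator_of_notMem (hρext hw) u) hz.2.le).trans hρmean,
        Metric.closedBall_subset_closedBall' (by linarith [hz.2])⟩
  have hlt : 10 / smallConst n ^ n * ρ * (energy G).real (Metric.closedBall p (3 * ρ)) <
      10 / smallConst n ^ n * ρ * (smallConst n ^ n / 10) := by
    gcongr
    exact hρE.trans_le (min_le_left _ _)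
  have hρeq : 10 / smallConst n ^ n * ρ * (smallConst n ^ n / 10) = ρ := by field_simp
  linarith

/-- The mean is compared along the ray from the origin through `x`, where the rings stay outside
`B(0, ρ)`, with a ring on which `v` vanishes. -/
theorem abs_ringMean_le_of_eq_zero (hn : n ≠ 0) (h : IsSobolevLimit v G) {M ρ : ℝ} (hM : 0 ≤ M)
    (hρ : 0 < ρ) (hv : ∀ x, M ≤ ‖x‖ → v x = 0) (hx : 2 * ρ ≤ ‖x‖) :
    |ringMean v x ρ| ≤ ringConst n * ((M + ρ) / ρ) *
      (energy G).real (Metric.ball 0 ρ)ᶜ ^ (1 / (n : ℝ)) := by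
  have hx0 : 0 < ‖x‖ := by linarith
  set w : Eucl n := ((M + ρ) / ‖x‖) • x with hw
  have hwn : ‖w‖ = M + ρ := by
    rw [hw, norm_smul, Real.norm_eq_abs, abs_of_nonneg (by positivity)]
    field_simp
  have hray (t : ℝ) (ht : 0 ≤ t) : ‖x + t • w‖ = ‖x‖ + t * (M + ρ) := by
    have hxw : x + t • w = (1 + t * ((M + ρ) / ‖x‖)) • x := by rw [hw]; module
    rw [hxw, norm_smul, Real.norm_eq_abs, abs_of_nonneg (by positivity)]
    field_simp
  have hout (t : ℝ) (ht : 0 ≤ t) (y : Eucl n) (hy : y ∈ Metric.closedBall (x + t • w) ρ) :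
      ‖x‖ + t * (M + ρ) - ρ ≤ ‖y‖ := by
    rw [← hray t ht]
    linarith [norm_sub_norm_le (x + t • w) y, mem_closedBall_iff_norm'.1 hy]
  have hzero : ringMean v (x + w) ρ = 0 := ringMean_eq_zero hρ fun y hy => hv _ <| by
    linarith [hout 1 zero_le_one y (by rw [one_smul]; exact Metric.ball_subset_closedBall hy)]
  have hle := abs_ringMean_sub_le_energy hn h (x := x) (x' := x + w) hρ le_rfl le_rfl
    (U := (Metric.ball 0 ρ)ᶜ) Metric.isOpen_ball.measurableSet.compl fun t ht y hy => ?_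
  · rwa [hzero, zero_sub, abs_neg, sub_self, abs_zero, add_zero, add_sub_cancel_left, hwn] at hle
  · rw [sub_self, mul_zero, add_zero, add_sub_cancel_left, mem_compl_iff, mem_ball_zero_iff, not_lt]
    have := hout t ht.1 _ (add_smul_mem_closedBall_of_mem_unitRing hρ.le
      (by rw [dist_self, zero_add]) hy)
    linarith [mul_nonneg ht.1 (by positivity : 0 ≤ M + ρ)]

theorem closedBall_subset_compl_ball {E : Type*} [SeminormedAddCommGroup E] {x : E} {r s : ℝ}
    (hx : r + s ≤ ‖x‖) : Metric.closedBall x r ⊆ (Metric.ball 0 s)ᶜ := by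
  intro y hy
  rw [mem_compl_iff, mem_ball_zero_iff, not_lt]
  linarith [norm_sub_norm_le x y, mem_closedBall_iff_norm'.1 hy]

theorem exists_forall_subset_ball_of_isPreconnected (hn : n ≠ 0) {M r : ℝ} (hM : 0 ≤ M)
    (hr : 0 < r) :
    ∃ κ : ℝ, 0 < κ ∧ ∀ (v : Eucl n → ℝ) (G : Eucl n → Eucl n), IsSobolevLimit v G →
      (∀ x, M ≤ ‖x‖ → v x = 0) → (energy G).real (Metric.ball 0 (r / 2))ᶜ < κ →
      ∀ A : Set (Eucl n), IsPreconnected A → (∀ x ∈ A, ContinuousAt v x ∧ 1 / 2 < |v x|) →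
        (A ∩ Metric.ball 0 r).Nonempty → A ⊆ Metric.ball 0 (2 * r) := by
  have hq := smallConst_pos hn
  have := ringConst_nonneg n
  set m := ringConst n * ((M + r / 2) / (r / 2))
  have hm : 0 ≤ m := by positivity
  refine ⟨min (smallConst n ^ n / 5) ((smallConst n / (m + 1)) ^ n), by positivity, ?_⟩
  rintro v G h hv hκ A hA hAv ⟨x, hxA, hx⟩ y hyA
  by_contra hy
  rw [mem_ball_zero_iff] at hx hy
  set E := (energy G).real (Metric.ball 0 (r / 2))ᶜ
  have hmean := mul_rpow_one_div_le hn hm hq.le measureReal_nonneg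
    (hκ.le.trans (min_le_right _ _))
  have hcross := sub_le_mul_energy_of_isPreconnected hn h (half_pos hr) hA hxA hyA
    (p := 0) (a := r) (b := 2 * r) (by simpa using hx.le) (by simpa using hy)
    (U := (Metric.ball 0 (r / 2))ᶜ) fun z hzA hz => by
      rw [dist_zero_right] at hz
      exact ⟨(hAv z hzA).1, (hAv z hzA).2,
        (abs_ringMean_le_of_eq_zero hn h hM (half_pos hr) hv (by linarith [hz.1])).trans hmean,
        closedBall_subset_compl_ball (by linarith [hz.1])⟩
  have hlt : 10 / smallConst n ^ n * (r / 2) * E <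
      10 / smallConst n ^ n * (r / 2) * (smallConst n ^ n / 5) := by
    gcongr
    exact hκ.trans_le (min_le_left _ _)
  have hreq : 10 / smallConst n ^ n * (r / 2) * (smallConst n ^ n / 5) = r := by
    field_simp
    norm_num
  linarith

end ZeroExtension

section ExponentialIntegrability

theorem ofReal_rpow_le_add_tsum {b : ℝ} (hb : 1 ≤ b) (y : ℝ) :
    ENNReal.ofReal (b ^ y) ≤
      ENNReal.ofReal b + ∑' K : ℕ, {s : ℝ | K + 1 < s}.indicator
        (fun _ => ENNReal.ofReal (b ^ (K + 2))) y := by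
  rcases le_or_gt y 1 with hy | hy
  · refine (ENNReal.ofReal_le_ofReal ?_).trans le_self_add
    simpa using Real.rpow_le_rpow_of_exponent_le hb hy
  · obtain ⟨K, hK⟩ : ∃ K, ⌈y⌉₊ = K + 2 :=
      Nat.exists_eq_add_of_le' (Nat.lt_ceil.2 (by exact_mod_cast hy) : 1 < ⌈y⌉₊)
    have hyK : y ≤ ((K + 2 : ℕ) : ℝ) := hK ▸ Nat.le_ceil y
    have hKy : (K : ℝ) + 1 < y := by
      exact_mod_cast Nat.lt_ceil.1 (by omega : K + 1 < ⌈y⌉₊)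
    calc ENNReal.ofReal (b ^ y) ≤ ENNReal.ofReal (b ^ (K + 2)) := by
          refine ENNReal.ofReal_le_ofReal ?_
          simpa only [Real.rpow_natCast] using Real.rpow_le_rpow_of_exponent_le hb hyK
      _ = {s : ℝ | K + 1 < s}.indicator (fun _ => ENNReal.ofReal (b ^ (K + 2))) y :=
          (indicator_of_mem (s := {s : ℝ | K + 1 < s}) hKy
            (fun _ => ENNReal.ofReal (b ^ (K + 2)))).symm
      _ ≤ _ := (ENNReal.le_tsum K).trans le_add_self

theorem setLIntegral_rpow_le_of_measure_le {X : Type*} [MeasurableSpace X] {μ : Measure X}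
    {S : Set X} (hS : MeasurableSet S) {y : X → ℝ} {b q C : ℝ} (hb : 1 ≤ b) (hq : 0 ≤ q)
    (hbq : b * q < 1) (hC : 0 ≤ C)
    (hy : ∀ K : ℕ, μ {x ∈ S | K + 1 < y x} ≤ ENNReal.ofReal (C * q ^ K)) :
    ∫⁻ x in S, ENNReal.ofReal (b ^ y x) ∂μ ≤
      ENNReal.ofReal b * μ S + ENNReal.ofReal (C * b ^ 2 / (1 - b * q)) := by
  set T : ℕ → Set X := fun K => toMeasurable μ {x ∈ S | K + 1 < y x}
  have hTm (K : ℕ) : MeasurableSet (T K) := measurableSet_toMeasurable _ _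
  set g : ℕ → X → ℝ≥0∞ := fun K => (T K).indicator fun _ => ENNReal.ofReal (b ^ (K + 2))
  have hpointwise : ∀ x ∈ S, ENNReal.ofReal (b ^ y x) ≤ ENNReal.ofReal b + ∑' K, g K x := by
    refine fun x hx => (ofReal_rpow_le_add_tsum hb (y x)).trans ?_
    gcongr with K
    refine indicator_apply_le' ?_ fun _ => zero_le
    exact fun hK => (indicator_of_mem (subset_toMeasurable μ {x ∈ S | K + 1 < y x} ⟨hx, hK⟩)
      (fun _ => ENNReal.ofReal (b ^ (K + 2)))).ge
  have hlayer (K : ℕ) :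
      ∫⁻ x in S, g K x ∂μ ≤ ENNReal.ofReal (C * b ^ 2 * (b * q) ^ K) := by
    refine (setLIntegral_le_lintegral _ _).trans ?_
    rw [lintegral_indicator_const (hTm K), measure_toMeasurable]
    refine (mul_le_mul_right (hy K) _).trans_eq ?_
    rw [← ENNReal.ofReal_mul (by positivity)]
    ring_nf
  have hgeom := (hasSum_geometric_of_lt_one (by positivity) hbq).mul_left (C * b ^ 2)
  calc ∫⁻ x in S, ENNReal.ofReal (b ^ y x) ∂μ
      ≤ ∫⁻ x in S, (ENNReal.ofReal b + ∑' K, g K x) ∂μ := setLIntegral_mono' hS hpointwise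
    _ = ENNReal.ofReal b * μ S + ∑' K, ∫⁻ x in S, g K x ∂μ := by
        rw [lintegral_add_left measurable_const, setLIntegral_const, lintegral_tsum]
        exact fun K => (measurable_const.indicator (hTm K)).aemeasurable
    _ ≤ ENNReal.ofReal b * μ S + ∑' K : ℕ, ENNReal.ofReal (C * b ^ 2 * (b * q) ^ K) := by
        gcongr with K
        exact hlayer K
    _ = _ := by
        rw [← ENNReal.ofReal_tsum_of_nonneg (fun K => by positivity) hgeom.summable,
          hgeom.tsum_eq, div_eq_mul_inv]

theorem exp_mul_sub_one_le {l t : ℝ} (hl : 0 ≤ l) (hl1 : l ≤ 1) :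
    Real.exp (l * t) - 1 ≤ l * Real.exp t := by
  have hconv := convexOn_exp.2 (mem_univ 0) (mem_univ t) (sub_nonneg.2 hl1) hl (by ring)
  simp only [smul_eq_mul, mul_zero, zero_add, Real.exp_zero, mul_one] at hconv
  linarith

variable {n : ℕ} {v : Eucl n → ℝ} {G : Eucl n → Eucl n}

theorem setLIntegral_rpow_le_of_energy_le (hn : 2 ≤ n) (h : IsSobolevLimit v G) {m η R : ℝ}
    (hR : 0 < R) (hm : 0 ≤ m) (hη : 0 < η) {S U : Set (Eucl n)} (hSm : MeasurableSet S)
    (hU : (energy G).real U ≤ η ^ n)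
    (hS : ∀ x ∈ S, ContinuousAt v x ∧ |ringMean v x R| ≤ m * η ∧ Metric.closedBall x R ⊆ U) :
    ∫⁻ x in S, ENNReal.ofReal
        ((3 / 2) ^ (|v x| / (pointwiseConst n m * η)) ^ ((n : ℝ) / ((n : ℝ) - 1))) ≤
      ENNReal.ofReal (3 / 2) * volume S +
        ENNReal.ofReal (9 * ((5 * R) ^ n * volume.real (Metric.ball (0 : Eucl n) 1))) := by
  have hn0 : n ≠ 0 := by omega
  have hn1 : (0 : ℝ) < (n : ℝ) - 1 := by
    rw [sub_pos]
    exact_mod_cast hn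
  have hb := pointwiseConst_pos hn0 hm
  have hC : 0 ≤ (5 * R) ^ n * volume.real (Metric.ball (0 : Eucl n) 1) := by positivity
  refine (setLIntegral_rpow_le_of_measure_le hSm (q := 1 / 2) (by norm_num) (by norm_num)
    (by norm_num) hC fun K => ?_).trans_eq (by ring_nf)
  have hp : 0 < (n : ℝ) / ((n : ℝ) - 1) := by positivity
  refine le_trans (measure_mono ?_) (volume_superlevel_le hn0 h hR hm hη hU hS K)
  refine fun x hx => ⟨hx.1, ?_⟩
  have hexp : ((((K : ℝ) + 1) ^ (n - 1)) ^ (1 / (n : ℝ))) ^ ((n : ℝ) / ((n : ℝ) - 1)) = K + 1 := by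
    rw [← Real.rpow_natCast, ← Real.rpow_mul (by positivity), ← Real.rpow_mul (by positivity),
      Nat.cast_sub (by omega), Nat.cast_one]
    field_simp
    exact Real.rpow_one _
  rw [← lt_div_iff₀' (by positivity),
    ← Real.rpow_lt_rpow_iff (by positivity) (by positivity) hp, hexp]
  exact hx.2

theorem exp_mul_rpow_sub_one_le {α l A b p s : ℝ} (hl : 0 ≤ l) (hl1 : l ≤ 1) (hA : 0 < A)
    (hb : 0 < b) (hs : 0 ≤ s) (hα : α * A ^ p = l * Real.log b) :
    Real.exp (α * s ^ p) - 1 ≤ l * b ^ (s / A) ^ p := by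
  have hscale : α * s ^ p = l * (Real.log b * (s / A) ^ p) := by
    rw [Real.div_rpow hs hA.le, ← mul_assoc, ← hα]
    field_simp
  rw [hscale, Real.rpow_def_of_pos hb]
  exact exp_mul_sub_one_le hl hl1

theorem setLIntegral_exp_sub_one_le_of_energy_le (hn : 2 ≤ n) (h : IsSobolevLimit v G)
    {α l m η R : ℝ} (hl : 0 ≤ l) (hl1 : l ≤ 1) (hR : 0 < R) (hm : 0 ≤ m) (hη : 0 < η)
    (hα : α * (pointwiseConst n m * η) ^ ((n : ℝ) / ((n : ℝ) - 1)) = l * Real.log (3 / 2))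
    {S U : Set (Eucl n)} (hSm : MeasurableSet S) (hU : (energy G).real U ≤ η ^ n)
    (hS : ∀ x ∈ S, ContinuousAt v x ∧ |ringMean v x R| ≤ m * η ∧ Metric.closedBall x R ⊆ U) :
    ∫⁻ x in S, ENNReal.ofReal (Real.exp (α * |v x| ^ ((n : ℝ) / ((n : ℝ) - 1))) - 1) ≤
      ENNReal.ofReal l * (ENNReal.ofReal (3 / 2) * volume S +
        ENNReal.ofReal (9 * ((5 * R) ^ n * volume.real (Metric.ball (0 : Eucl n) 1)))) := by
  have hb := pointwiseConst_pos (by omega : n ≠ 0) hm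
  refine le_trans ?_ (mul_le_mul_right
    (setLIntegral_rpow_le_of_energy_le hn h hR hm hη hSm hU hS) _)
  rw [← lintegral_const_mul' _ _ ENNReal.ofReal_ne_top]
  refine lintegral_mono fun x => ?_
  rw [← ENNReal.ofReal_mul hl]
  exact ENNReal.ofReal_le_ofReal
    (exp_mul_rpow_sub_one_le hl hl1 (by positivity) (by norm_num) (abs_nonneg _) hα)

theorem exists_forall_setLIntegral_exp_sub_one_le (hn : 2 ≤ n) {M ρ α δ : ℝ} (hM : 0 ≤ M)
    (hρ : 0 < ρ) (hα : 0 < α) (hδ : 0 < δ) :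
    ∃ κ : ℝ, 0 < κ ∧ ∀ (v : Eucl n → ℝ) (G : Eucl n → Eucl n), IsSobolevLimit v G →
      (∀ x, M ≤ ‖x‖ → v x = 0) → (energy G).real (Metric.ball 0 ρ)ᶜ < κ →
      ∀ S : Set (Eucl n), MeasurableSet S → S ⊆ Metric.ball 0 M →
        (∀ x ∈ S, ContinuousAt v x ∧ 2 * ρ ≤ ‖x‖) →
        ∫⁻ x in S, ENNReal.ofReal (Real.exp (α * |v x| ^ ((n : ℝ) / ((n : ℝ) - 1))) - 1) ≤
          ENNReal.ofReal δ := by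
  have hn0 : n ≠ 0 := by omega
  have hn1 : (0 : ℝ) < (n : ℝ) - 1 := by
    rw [sub_pos]
    exact_mod_cast hn
  have := ringConst_nonneg n
  set m := ringConst n * ((M + ρ) / ρ)
  have hm : 0 ≤ m := by positivity
  have hb := pointwiseConst_pos hn0 hm
  set Q := 3 / 2 * volume.real (Metric.ball (0 : Eucl n) M) +
    9 * ((5 * ρ) ^ n * volume.real (Metric.ball (0 : Eucl n) 1))
  have : 0 ≤ Q := by positivity
  set l := min 1 (δ / (Q + 1))
  have hl : 0 < l := by positivity
  have hlQ : l * Q ≤ δ := calc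
    l * Q ≤ δ / (Q + 1) * (Q + 1) := by gcongr <;> [exact min_le_right _ _; linarith]
    _ = δ := div_mul_cancel₀ _ (by positivity)
  have : 0 < Real.log (3 / 2) := Real.log_pos (by norm_num)
  set η := (l * Real.log (3 / 2) / α) ^ ((n : ℝ) / ((n : ℝ) - 1))⁻¹ / pointwiseConst n m with hη
  have hη0 : 0 < η := by positivity
  have hαη : α * (pointwiseConst n m * η) ^ ((n : ℝ) / ((n : ℝ) - 1)) = l * Real.log (3 / 2) := by
    rw [hη, mul_div_cancel₀ _ hb.ne', Real.rpow_inv_rpow (by positivity) (by positivity),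
      mul_div_cancel₀ _ hα.ne']
  refine ⟨η ^ n, by positivity, fun v G h hv hE S hS hSM hSv => ?_⟩
  have hmean (x : Eucl n) (hx : 2 * ρ ≤ ‖x‖) : |ringMean v x ρ| ≤ m * η := by
    refine (abs_ringMean_le_of_eq_zero hn0 h hM hρ hv hx).trans ?_
    gcongr
    rw [one_div, Real.rpow_inv_le_iff_of_pos measureReal_nonneg (by positivity) (by positivity),
      Real.rpow_natCast]
    exact hE.le
  calc _ ≤ _ := setLIntegral_exp_sub_one_le_of_energy_le hn h hl.le (min_le_left _ _) hρ hm hη0 hαη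
        hS hE.le fun x hx => ⟨(hSv x hx).1, hmean x (hSv x hx).2,
          closedBall_subset_compl_ball (by linarith [(hSv x hx).2])⟩
    _ ≤ ENNReal.ofReal l * ENNReal.ofReal Q := by
        rw [ENNReal.ofReal_add (by positivity) (by positivity),
          ENNReal.ofReal_mul (p := 3 / 2) (by norm_num), ofReal_measureReal measure_ball_lt_top.ne]
        gcongr
    _ ≤ ENNReal.ofReal δ := by
        rw [← ENNReal.ofReal_mul hl.le]
        exact ENNReal.ofReal_le_ofReal hlQ

theorem integrableOn_ball_norm_rpow (hn : n ≠ 0) {β : ℝ} (hβ : β < n) :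
    IntegrableOn (fun x : Eucl n => 1 / ‖x‖ ^ β) (Metric.ball 0 1) := by
  have := nontrivial_eucl hn
  rw [integrableOn_fun_norm_addHaar volume (f := fun t : ℝ => 1 / t ^ β),
    finrank_euclideanSpace_fin]
  have hint : IntegrableOn (fun t : ℝ => t ^ ((n : ℝ) - 1 - β)) (Ioo 0 1) :=
    (intervalIntegral.integrableOn_Ioo_rpow_iff zero_lt_one).2 (by linarith)
  refine hint.congr_fun (fun t ht => ?_) measurableSet_Ioo
  simp only [smul_eq_mul]
  rw [Real.rpow_sub ht.1, ← Real.rpow_natCast, Nat.cast_sub (Nat.one_le_iff_ne_zero.2 hn),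
    Nat.cast_one]
  ring

theorem tendsto_volume_ball_zero (hn : n ≠ 0) (x : Eucl n) :
    Tendsto (fun ε : ℝ => volume (Metric.ball x ε)) (𝓝[>] 0) (𝓝 0) := by
  have hlim : Tendsto (fun ε : ℝ => ENNReal.ofReal (ε ^ n) * volume (Metric.ball (0 : Eucl n) 1))
      (𝓝[>] 0) (𝓝 (ENNReal.ofReal (0 ^ n) * volume (Metric.ball (0 : Eucl n) 1))) :=
    ENNReal.Tendsto.mul_const (ENNReal.tendsto_ofReal
      ((tendsto_nhdsWithin_of_tendsto_nhds tendsto_id).pow n)) (Or.inr measure_ball_lt_top.ne)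
  rw [zero_pow hn, ENNReal.ofReal_zero, zero_mul] at hlim
  refine hlim.congr' ?_
  filter_upwards [self_mem_nhdsWithin] with ε hε
  rw [Measure.addHaar_ball_of_pos _ _ hε, finrank_euclideanSpace_fin]

theorem tendsto_lintegral_ball_norm_rpow (hn : n ≠ 0) {β : ℝ} (hβ : β < n) :
    Tendsto (fun ε : ℝ => ∫⁻ x in Metric.ball (0 : Eucl n) ε, ENNReal.ofReal (1 / ‖x‖ ^ β))
      (𝓝[>] 0) (𝓝 0) := by
  have hint : ∫⁻ x in Metric.ball (0 : Eucl n) 1, ENNReal.ofReal (1 / ‖x‖ ^ β) ≠ ⊤ := by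
    have hfin := (integrableOn_ball_norm_rpow hn hβ).2
    rw [hasFiniteIntegral_iff_ofReal (Eventually.of_forall fun x => by positivity)] at hfin
    exact hfin.ne
  have hvol : Tendsto ((volume.restrict (Metric.ball (0 : Eucl n) 1)) ∘
      fun ε : ℝ => Metric.ball (0 : Eucl n) ε) (𝓝[>] 0) (𝓝 0) :=
    tendsto_of_tendsto_of_tendsto_of_le_of_le tendsto_const_nhds (tendsto_volume_ball_zero hn 0)
      (fun _ => zero_le) fun ε => Measure.restrict_apply_le _ _
  refine (tendsto_setLIntegral_zero hint hvol).congr' ?_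
  filter_upwards [eventually_nhdsWithin_of_eventually_nhds (eventually_lt_nhds one_pos)] with ε hε
  rw [Measure.restrict_restrict Metric.isOpen_ball.measurableSet,
    inter_eq_left.2 (Metric.ball_subset_ball hε.le)]

section Functional

variable {α β : ℝ} {Ω S : Set (Eucl n)}

theorem F_inter_add_F_diff (hS : MeasurableSet S) (v : Eucl n → ℝ) :
    F α β (Ω ∩ S) v + F α β (Ω \ S) v = F α β Ω v :=
  lintegral_inter_add_sdiff _ Ω hS

theorem F_le_of_abs_le (hn : n ≠ 0) (hα : 0 ≤ α) (hS : MeasurableSet S) {B : ℝ}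
    (hv : ∀ x ∈ S, |v x| ≤ B) :
    F α β S v ≤ ENNReal.ofReal (Real.exp (α * B ^ ((n : ℝ) / ((n : ℝ) - 1)))) *
      ∫⁻ x in S, ENNReal.ofReal (1 / ‖x‖ ^ β) := by
  have : 0 ≤ (n : ℝ) - 1 := sub_nonneg.2 (by exact_mod_cast Nat.one_le_iff_ne_zero.2 hn)
  rw [F, ← lintegral_const_mul' _ _ ENNReal.ofReal_ne_top]
  refine setLIntegral_mono' hS fun x hx => ?_
  rw [← ENNReal.ofReal_mul (Real.exp_pos _).le, mul_one_div]
  have hle : Real.exp (α * |v x| ^ ((n : ℝ) / ((n : ℝ) - 1))) ≤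
      Real.exp (α * B ^ ((n : ℝ) / ((n : ℝ) - 1))) := by
    gcongr
    exact hv x hx
  gcongr
  linarith

theorem F_le_of_le_norm (hα : 0 ≤ α) (hβ : 0 ≤ β) (hS : MeasurableSet S) {ε : ℝ} (hε : 0 < ε)
    (hεS : ∀ x ∈ S, ε ≤ ‖x‖) :
    F α β S v ≤ ENNReal.ofReal (1 / ε ^ β) * ∫⁻ x in S, ENNReal.ofReal
      (Real.exp (α * |v x| ^ ((n : ℝ) / ((n : ℝ) - 1))) - 1) := by
  rw [F, ← lintegral_const_mul' _ _ ENNReal.ofReal_ne_top]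
  refine setLIntegral_mono' hS fun x hx => ?_
  have : 0 ≤ Real.exp (α * |v x| ^ ((n : ℝ) / ((n : ℝ) - 1))) - 1 :=
    sub_nonneg.2 (Real.one_le_exp (by positivity))
  rw [← ENNReal.ofReal_mul (by positivity), one_div_mul_eq_div]
  gcongr
  exact hεS x hx

theorem exists_forall_F_diff_ball_le (hn : 2 ≤ n) (hα : 0 < α) (hβ : 0 ≤ β) (hΩ : IsOpen Ω)
    (hΩb : Bornology.IsBounded Ω) {ε δ : ℝ} (hε : 0 < ε) (hδ : 0 < δ) :
    ∃ κ : ℝ, 0 < κ ∧ ∀ v : Eucl n → ℝ, MemW1n0 Ω v → ContinuousOn v Ω →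
      (energy (Ω.indicator (weakGrad Ω v))).real (Metric.ball 0 (ε / 2))ᶜ < κ →
      F α β (Ω \ Metric.ball 0 ε) v ≤ ENNReal.ofReal δ := by
  obtain ⟨M, hM, hΩM⟩ := hΩb.subset_ball_lt 0 0
  obtain ⟨κ, hκ, hexp⟩ := exists_forall_setLIntegral_exp_sub_one_le hn hM.le (half_pos hε) hα
    (δ := δ * ε ^ β) (by positivity)
  have hSm : MeasurableSet (Ω \ Metric.ball (0 : Eucl n) ε) :=
    hΩ.measurableSet.diff Metric.isOpen_ball.measurableSet
  have hεx {x : Eucl n} (hx : x ∈ Ω \ Metric.ball 0 ε) : ε ≤ ‖x‖ := by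
    simpa only [mem_ball_zero_iff, not_lt] using hx.2
  refine ⟨κ, hκ, fun v hv hvc hE => ?_⟩
  have hzero (x : Eucl n) (hx : M ≤ ‖x‖) : Ω.indicator v x = 0 :=
    indicator_of_notMem (fun hxΩ => hx.not_gt (mem_ball_zero_iff.1 (hΩM hxΩ))) _
  have hint := hexp _ _ (hv.isSobolevLimit hΩ) hzero hE _ hSm (sdiff_subset.trans hΩM)
    fun x hx => ⟨continuousAt_indicator_of_mem hΩ hvc hx.1, by linarith [hεx hx]⟩
  calc F α β (Ω \ Metric.ball 0 ε) v
      = F α β (Ω \ Metric.ball 0 ε) (Ω.indicator v) :=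
        setLIntegral_congr_fun hSm fun x hx => by simp only [indicator_of_mem hx.1]
    _ ≤ ENNReal.ofReal (1 / ε ^ β) * ENNReal.ofReal (δ * ε ^ β) :=
        (F_le_of_le_norm hα.le hβ hSm hε fun x => hεx).trans (by gcongr)
    _ = ENNReal.ofReal δ := by
        rw [← ENNReal.ofReal_mul (by positivity)]
        congr 1
        field_simp

theorem tendsto_F_zero_of_abs_le_on_ball (hn : 2 ≤ n) (hα : 0 < α) (hβ : 0 ≤ β) (hβn : β < n)
    (hΩ : IsOpen Ω) (hΩb : Bornology.IsBounded Ω) {u : ℕ → Eucl n → ℝ}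
    (hu : ∀ i, MemW1n0 Ω (u i)) (huc : ∀ i, ContinuousOn (u i) Ω)
    (hconc : ∀ ε : ℝ, 0 < ε → Tendsto (fun i =>
      (energy (Ω.indicator (weakGrad Ω (u i)))).real (Metric.ball 0 ε)ᶜ) atTop (𝓝 0))
    {r B : ℝ} (hr : 0 < r) (hB : ∀ᶠ i in atTop, ∀ x ∈ Ω ∩ Metric.ball 0 r, |u i x| ≤ B) :
    Tendsto (fun i => F α β Ω (u i)) atTop (𝓝 0) := by
  have hn0 : n ≠ 0 := by omega
  rw [ENNReal.tendsto_nhds_zero]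
  intro δ hδ
  obtain ⟨δ', hδ', hδδ⟩ := ENNReal.lt_iff_exists_nnreal_btwn.1 (ENNReal.half_pos hδ.ne')
  have hδ0 : (0 : ℝ) < δ' := by exact_mod_cast hδ'
  have hlim := ENNReal.Tendsto.const_mul
    (a := ENNReal.ofReal (Real.exp (α * B ^ ((n : ℝ) / ((n : ℝ) - 1)))))
    (tendsto_lintegral_ball_norm_rpow hn0 hβn) (Or.inr ENNReal.ofReal_ne_top)
  rw [mul_zero] at hlim
  obtain ⟨ε, hε, hεr, hεδ⟩ := ((eventually_mem_nhdsWithin (a := (0 : ℝ)) (s := Ioi 0)).and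
    ((eventually_nhdsWithin_of_eventually_nhds (eventually_lt_nhds hr)).and
      (hlim.eventually_lt_const (ENNReal.half_pos hδ.ne')))).exists
  obtain ⟨κ, hκ, hfar⟩ := exists_forall_F_diff_ball_le (β := β) hn hα hβ hΩ hΩb hε hδ0
  filter_upwards [hB, (hconc _ (half_pos hε)).eventually_lt_const hκ] with i hi hE
  rw [← F_inter_add_F_diff (Metric.isOpen_ball (x := (0 : Eucl n)) (ε := ε)).measurableSet,
    ← ENNReal.add_halves δ]
  gcongr
  · refine (F_le_of_abs_le hn0 hα.le (hΩ.inter Metric.isOpen_ball).measurableSet fun x hx =>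
      hi x ⟨hx.1, Metric.ball_subset_ball hεr.le hx.2⟩).trans (le_trans ?_ hεδ.le)
    gcongr
    exact inter_subset_right
  · refine (hfar _ (hu i) (huc i) hE).trans (le_trans ?_ hδδ.le)
    rw [ENNReal.ofReal_coe_nnreal]

end Functional

end ExponentialIntegrability

section WeakGradient

variable {n : ℕ} {Ω : Set (Eucl n)} {φ ψ v : Eucl n → ℝ} {G G' : Eucl n → Eucl n}

theorem integral_smul_gradient_eq_neg (hφ : ContDiff ℝ 1 φ) (hψ : ContDiff ℝ 1 ψ)
    (hψc : HasCompactSupport ψ) :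
    ∫ x, φ x • gradient ψ x = -∫ x, ψ x • gradient φ x := by
  have hφψ : Integrable fun x => φ x • gradient ψ x :=
    (hφ.continuous.smul (continuous_gradient hψ)).integrable_of_hasCompactSupport
      (hasCompactSupport_gradient hψc).smul_left
  have hψφ : Integrable fun x => ψ x • gradient φ x :=
    (hψ.continuous.smul (continuous_gradient hφ)).integrable_of_hasCompactSupport hψc.smul_right
  refine ext_inner_right ℝ fun w => ?_
  have hinner (χ : Eucl n → ℝ) (x : Eucl n) : inner ℝ w (gradient χ x) = fderiv ℝ χ x w := by
    rw [real_inner_comm]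
    exact InnerProductSpace.toDual_symm_apply
  have hderiv {χ : Eucl n → ℝ} (hχ : ContDiff ℝ 1 χ) : Continuous fun x => fderiv ℝ χ x w :=
    (hχ.continuous_fderiv (by simp)).clm_apply continuous_const
  rw [inner_neg_left, real_inner_comm, real_inner_comm w (∫ x, ψ x • gradient φ x),
    ← integral_inner hφψ, ← integral_inner hψφ]
  simp only [inner_smul_right, hinner]
  rw [integral_mul_fderiv_eq_neg_fderiv_mul_of_integrable _ _ _
    (fun x _ => (hφ.differentiable (by simp)).differentiableAt)
    (fun x _ => (hψ.differentiable (by simp)).differentiableAt)]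
  · simp only [mul_comm]
  · exact ((hderiv hφ).mul hψ.continuous).integrable_of_hasCompactSupport hψc.mul_left
  · exact (hφ.continuous.mul (hderiv hψ)).integrable_of_hasCompactSupport
      (hψc.fderiv_apply ℝ w).mul_left
  · exact (hφ.continuous.mul hψ.continuous).integrable_of_hasCompactSupport hψc.mul_left

theorem setIntegral_smul_eq_integral_of_tsupport_subset (hφ : tsupport φ ⊆ Ω)
    (G : Eucl n → Eucl n) : ∫ x in Ω, φ x • G x = ∫ x, φ x • G x :=
  setIntegral_eq_integral_of_forall_compl_eq_zero fun x hx => by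
    rw [image_eq_zero_of_notMem_tsupport fun h => hx (hφ h), zero_smul]

theorem hasWeakGradient_gradient (hφ : ContDiff ℝ 1 φ) : HasWeakGradient Ω φ (gradient φ) := by
  refine ⟨hφ.continuous.locallyIntegrable.locallyIntegrableOn _,
    (continuous_gradient hφ).locallyIntegrable.locallyIntegrableOn _, fun ψ ⟨hψ, hψc, hψΩ⟩ => ?_⟩
  rw [setIntegral_smul_eq_integral_of_tsupport_subset hψΩ,
    setIntegral_eq_integral_of_forall_compl_eq_zero fun x hx => ?_,
    integral_smul_gradient_eq_neg hφ (hψ.of_le (by simp)) hψc]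
  rw [gradient_eq_zero_of_notMem_tsupport fun h => hx (hψΩ h), smul_zero]

theorem IsTestFunction.integrableOn_smul (hφ : IsTestFunction Ω φ)
    (hG : LocallyIntegrableOn G Ω volume) : IntegrableOn (fun x => φ x • G x) Ω := by
  obtain ⟨hφs, hφc, hφΩ⟩ := hφ
  have hint : IntegrableOn (fun x => φ x • G x) (tsupport φ) :=
    (hG.integrableOn_compact_subset hφΩ hφc).continuousOn_smul hφs.continuous.continuousOn hφc
  have hsupp : Function.support (fun x => φ x • G x) ⊆ tsupport φ :=
    (Function.support_smul_subset_left φ G).trans (subset_tsupport φ)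
  exact ((integrableOn_iff_integrable_of_support_subset hsupp).1 hint).integrableOn

theorem HasWeakGradient.ae_eq (hΩ : IsOpen Ω) (hG : HasWeakGradient Ω v G)
    (hG' : HasWeakGradient Ω v G') : G =ᵐ[volume.restrict Ω] G' := by
  have hzero := hΩ.ae_eq_zero_of_integral_contDiff_smul_eq_zero (μ := volume)
    (hG.2.1.sub hG'.2.1) fun ψ hψ hψc hψΩ => ?_
  · rw [EventuallyEq, ae_restrict_iff' hΩ.measurableSet]
    filter_upwards [hzero] with x hx hxΩ
    exact sub_eq_zero.1 (hx hxΩ)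
  · have hψt : IsTestFunction Ω ψ := ⟨hψ, hψc, hψΩ⟩
    rw [← setIntegral_smul_eq_integral_of_tsupport_subset hψΩ]
    simp only [Pi.sub_apply, smul_sub]
    rw [integral_sub (hψt.integrableOn_smul hG.2.1) (hψt.integrableOn_smul hG'.2.1), sub_eq_zero]
    exact neg_injective ((hG.2.2 ψ hψt).symm.trans (hG'.2.2 ψ hψt))

theorem hasWeakGradient_weakGrad (h : ∃ G, HasWeakGradient Ω v G) :
    HasWeakGradient Ω v (weakGrad Ω v) := by
  rw [weakGrad, dif_pos h]
  exact h.choose_spec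

theorem weakGrad_ae_eq_gradient (hΩ : IsOpen Ω) (hφ : ContDiff ℝ 1 φ) :
    weakGrad Ω φ =ᵐ[volume.restrict Ω] gradient φ :=
  (hasWeakGradient_weakGrad ⟨_, hasWeakGradient_gradient hφ⟩).ae_eq hΩ (hasWeakGradient_gradient hφ)

theorem IsTestFunction.memW1n0 (hΩ : IsOpen Ω) (hφ : IsTestFunction Ω φ) : MemW1n0 Ω φ := by
  have hφ1 : ContDiff ℝ 1 φ := hφ.1.of_le (by simp)
  have hae := weakGrad_ae_eq_gradient hΩ hφ1
  refine ⟨⟨⟨_, hasWeakGradient_gradient hφ1⟩,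
    (hφ.1.continuous.memLp_of_hasCompactSupport hφ.2.1).restrict _, (memLp_congr_ae hae).2 ?_⟩,
    fun ε hε => ⟨φ, hφ, by simpa using hε, ?_⟩⟩
  · exact ((continuous_gradient hφ1).memLp_of_hasCompactSupport
      (hasCompactSupport_gradient hφ.2.1)).restrict _
  · have hdiff : (fun x => weakGrad Ω φ x - gradient φ x) =ᵐ[volume.restrict Ω] 0 := by
      filter_upwards [hae] with x hx using sub_eq_zero.2 hx
    rwa [eLpNorm_congr_ae hdiff, eLpNorm_zero]

end WeakGradient

section MoserFunctions

/-- The slope of the profile of the Moser functions: a smooth version of the indicator function of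
`[0, L]`. -/
noncomputable def moserSlope (L s : ℝ) : ℝ :=
  Real.smoothTransition s * Real.smoothTransition (L - s)

/-- The profile of the Moser functions: it vanishes on `(-∞, 0]`, is constant on `[L, ∞)` and has
slope `1` on `[1, L - 1]`. -/
noncomputable def moserProfile (L t : ℝ) : ℝ := ∫ s in (0 : ℝ)..t, moserSlope L s

open Classical in
/-- A smooth version of Moser's truncated logarithm `min (L, log (R / |x|))⁺`. -/
noncomputable def moserFun (n : ℕ) (R L : ℝ) (x : Eucl n) : ℝ :=
  if x = 0 then moserProfile L L else moserProfile L (Real.log R - Real.log ‖x‖)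

section Profile

variable {L s t : ℝ}

theorem contDiff_moserSlope (L : ℝ) : ContDiff ℝ ∞ (moserSlope L) :=
  Real.smoothTransition.contDiff.mul
    (Real.smoothTransition.contDiff.comp (contDiff_const.sub contDiff_id))

theorem continuous_moserSlope (L : ℝ) : Continuous (moserSlope L) :=
  (contDiff_moserSlope L).continuous

theorem moserSlope_nonneg (L s : ℝ) : 0 ≤ moserSlope L s :=
  mul_nonneg (Real.smoothTransition.nonneg _) (Real.smoothTransition.nonneg _)

theorem moserSlope_le_one (L s : ℝ) : moserSlope L s ≤ 1 :=
  mul_le_one₀ (Real.smoothTransition.le_one _) (Real.smoothTransition.nonneg _)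
    (Real.smoothTransition.le_one _)

theorem moserSlope_of_nonpos (hs : s ≤ 0) : moserSlope L s = 0 := by
  rw [moserSlope, Real.smoothTransition.zero_of_nonpos hs, zero_mul]

theorem moserSlope_of_ge (hs : L ≤ s) : moserSlope L s = 0 := by
  rw [moserSlope, Real.smoothTransition.zero_of_nonpos (sub_nonpos.2 hs), mul_zero]

theorem moserSlope_eq_one (hs : 1 ≤ s) (hsL : s ≤ L - 1) : moserSlope L s = 1 := by
  rw [moserSlope, Real.smoothTransition.one_of_one_le hs,
    Real.smoothTransition.one_of_one_le (by linarith), mul_one]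

theorem hasDerivAt_moserProfile (L t : ℝ) : HasDerivAt (moserProfile L) (moserSlope L t) t :=
  (continuous_moserSlope L).integral_hasStrictDerivAt 0 t |>.hasDerivAt

theorem contDiff_moserProfile (L : ℝ) : ContDiff ℝ ∞ (moserProfile L) := by
  rw [contDiff_infty_iff_deriv]
  refine ⟨fun t => (hasDerivAt_moserProfile L t).differentiableAt, ?_⟩
  rw [funext fun t => (hasDerivAt_moserProfile L t).deriv]
  exact contDiff_moserSlope L

theorem moserProfile_of_nonpos (ht : t ≤ 0) : moserProfile L t = 0 := by
  refine intervalIntegral.integral_zero_ae (Eventually.of_forall fun s hs => ?_)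
  exact moserSlope_of_nonpos (uIoc_of_ge ht ▸ hs).2

theorem moserProfile_of_ge (ht : L ≤ t) : moserProfile L t = moserProfile L L := by
  have hzero : ∫ s in L..t, moserSlope L s = 0 :=
    intervalIntegral.integral_zero_ae (Eventually.of_forall fun s hs =>
      moserSlope_of_ge (uIoc_of_le ht ▸ hs).1.le)
  rw [moserProfile, moserProfile, ← intervalIntegral.integral_add_adjacent_intervals
    ((continuous_moserSlope L).intervalIntegrable 0 L)
    ((continuous_moserSlope L).intervalIntegrable L t), hzero, add_zero]

theorem sub_two_le_moserProfile (hL : 2 ≤ L) : L - 2 ≤ moserProfile L L :=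
  calc L - 2 = ∫ _ in (1 : ℝ)..(L - 1), (1 : ℝ) := by
        rw [intervalIntegral.integral_const, smul_eq_mul, mul_one]
        ring
    _ = ∫ s in (1 : ℝ)..(L - 1), moserSlope L s := by
        refine intervalIntegral.integral_congr fun s hs => ?_
        rw [uIcc_of_le (by linarith)] at hs
        exact (moserSlope_eq_one hs.1 hs.2).symm
    _ ≤ moserProfile L L :=
        intervalIntegral.integral_mono_interval zero_le_one (by linarith) (by linarith)
          (Eventually.of_forall (moserSlope_nonneg L))
          ((continuous_moserSlope L).intervalIntegrable _ _)

theorem le_log_sub_log_iff {R : ℝ} (hR : 0 < R) (ht : 0 < t) :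
    s ≤ Real.log R - Real.log t ↔ t ≤ R * Real.exp (-s) := by
  rw [← Real.log_le_log_iff ht (by positivity), Real.log_mul hR.ne' (Real.exp_pos _).ne',
    Real.log_exp]
  constructor <;> intro h <;> linarith

theorem log_sub_log_le_iff {R : ℝ} (hR : 0 < R) (ht : 0 < t) :
    Real.log R - Real.log t ≤ s ↔ R * Real.exp (-s) ≤ t := by
  rw [← Real.log_le_log_iff (by positivity) ht, Real.log_mul hR.ne' (Real.exp_pos _).ne',
    Real.log_exp]
  constructor <;> intro h <;> linarith

end Profile

variable {n : ℕ} {R L : ℝ} {x : Eucl n}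

theorem moserFun_of_ne_zero (hx : x ≠ 0) :
    moserFun n R L x = moserProfile L (Real.log R - Real.log ‖x‖) := if_neg hx

theorem moserFun_eq_const (hR : 0 < R) (hx : ‖x‖ ≤ R * Real.exp (-L)) :
    moserFun n R L x = moserProfile L L := by
  by_cases hx0 : x = 0
  · exact if_pos hx0
  · rw [moserFun_of_ne_zero hx0]
    exact moserProfile_of_ge ((le_log_sub_log_iff hR (norm_pos_iff.2 hx0)).2 hx)

theorem moserFun_eq_zero (hR : 0 < R) (hx : R ≤ ‖x‖) : moserFun n R L x = 0 := by
  rw [moserFun_of_ne_zero (norm_pos_iff.1 (hR.trans_le hx))]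
  exact moserProfile_of_nonpos (sub_nonpos.2 (Real.log_le_log hR hx))

theorem moserFun_eventuallyEq (hx : x ≠ 0) :
    moserFun n R L =ᶠ[𝓝 x] fun y => moserProfile L (Real.log R - Real.log ‖y‖) := by
  filter_upwards [isOpen_ne.mem_nhds hx] with y hy using moserFun_of_ne_zero hy

theorem moserFun_eventuallyEq_const (hR : 0 < R) :
    moserFun n R L =ᶠ[𝓝 0] fun _ => moserProfile L L := by
  have hball : Metric.ball (0 : Eucl n) (R * Real.exp (-L)) ∈ 𝓝 0 :=
    Metric.ball_mem_nhds _ (by positivity)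
  filter_upwards [hball] with y hy using moserFun_eq_const hR (mem_ball_zero_iff.1 hy).le

theorem contDiff_moserFun (hR : 0 < R) : ContDiff ℝ ∞ (moserFun n R L) := by
  refine contDiff_iff_contDiffAt.2 fun x => ?_
  by_cases hx : x = 0
  · subst hx
    exact contDiffAt_const.congr_of_eventuallyEq (moserFun_eventuallyEq_const hR)
  · refine ContDiffAt.congr_of_eventuallyEq ?_ (moserFun_eventuallyEq hx)
    refine (contDiff_moserProfile L).contDiffAt.comp x ?_
    exact contDiffAt_const.sub ((contDiffAt_norm ℝ hx).log (norm_ne_zero_iff.2 hx))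

-- At `x = 0` the gradient vanishes, and so does the right-hand side because `0⁻¹ = 0`.
theorem norm_gradient_moserFun (hR : 0 < R) (x : Eucl n) :
    ‖gradient (moserFun n R L) x‖ = moserSlope L (Real.log R - Real.log ‖x‖) * ‖x‖⁻¹ := by
  by_cases hx : x = 0
  · rw [hx, norm_gradient, (moserFun_eventuallyEq_const hR).fderiv_eq, fderiv_const_apply]
    simp only [norm_zero, inv_zero, mul_zero]
  · have : Nontrivial (Eucl n) := ⟨x, 0, hx⟩
    have hnorm : DifferentiableAt ℝ (fun y : Eucl n => ‖y‖) x :=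
      (contDiffAt_norm ℝ (n := 1) hx).differentiableAt (by simp)
    have hcomp := (hasDerivAt_moserProfile L (Real.log R - Real.log ‖x‖)).comp_hasFDerivAt x
      ((hnorm.hasFDerivAt.log (norm_ne_zero_iff.2 hx)).const_sub (Real.log R))
    rw [norm_gradient, ((moserFun_eventuallyEq hx).hasFDerivAt_iff.2 hcomp).fderiv, norm_smul,
      norm_neg, norm_smul, norm_fderiv_norm hnorm, mul_one, norm_inv, norm_norm, Real.norm_eq_abs,
      abs_of_nonneg (moserSlope_nonneg _ _)]

theorem tsupport_moserFun_subset (hR : 0 < R) :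
    tsupport (moserFun n R L) ⊆ Metric.closedBall 0 R := by
  refine closure_minimal (fun x hx => ?_) Metric.isClosed_closedBall
  rw [mem_closedBall_zero_iff]
  exact (lt_of_not_ge fun h => hx (moserFun_eq_zero hR h)).le

theorem hasCompactSupport_moserFun (hR : 0 < R) : HasCompactSupport (moserFun n R L) :=
  (isCompact_closedBall _ _).of_isClosed_subset (isClosed_tsupport _) (tsupport_moserFun_subset hR)

end MoserFunctions

section MoserSequence

variable {n : ℕ} {Ω : Set (Eucl n)} {φ : Eucl n → ℝ} {R L α β : ℝ}

theorem volume_real_unit_ball_pos (n : ℕ) : 0 < volume.real (Metric.ball (0 : Eucl n) 1) :=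
  ENNReal.toReal_pos (Metric.measure_ball_pos volume _ one_pos).ne' measure_ball_lt_top.ne

theorem sphereArea_eq (hn : n ≠ 0) :
    sphereArea n = n * volume.real (Metric.ball (0 : Eucl n) 1) := by
  have := nontrivial_eucl hn
  rw [sphereArea, Measure.toSphere_real_apply_univ, finrank_euclideanSpace_fin]

theorem sphereArea_pos (hn : n ≠ 0) : 0 < sphereArea n := by
  rw [sphereArea_eq hn]
  exact mul_pos (by positivity) (volume_real_unit_ball_pos n)

section Annulus

variable {a b : ℝ}

theorem pow_smul_indicator_Ioo_inv_pow (hn : n ≠ 0) (ha : 0 ≤ a) :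
    (fun t : ℝ => t ^ (n - 1) • (Ioo a b).indicator (fun s => s⁻¹ ^ n) t) =
      (Ioo a b).indicator fun t => t⁻¹ := by
  ext t
  by_cases ht : t ∈ Ioo a b
  · have ht0 : t ≠ 0 := (ha.trans_lt ht.1).ne'
    rw [indicator_of_mem ht, indicator_of_mem ht, smul_eq_mul, inv_pow,
      ← pow_sub_one_mul hn t, mul_inv, mul_inv_cancel_left₀ (pow_ne_zero _ ht0)]
  · rw [indicator_of_notMem ht, indicator_of_notMem ht, smul_zero]

theorem integrable_indicator_Ioo_norm_inv_pow (hn : n ≠ 0) (ha : 0 < a) :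
    Integrable fun x : Eucl n => (Ioo a b).indicator (fun t => t⁻¹ ^ n) ‖x‖ := by
  have := nontrivial_eucl hn
  have hinv : IntegrableOn (fun t : ℝ => t⁻¹) (Ioo a b) :=
    (ContinuousOn.integrableOn_Icc (continuousOn_id.inv₀ fun t ht =>
      (ha.trans_le ht.1).ne')).mono_set Ioo_subset_Icc_self
  rw [integrable_fun_norm_addHaar volume, finrank_euclideanSpace_fin,
    pow_smul_indicator_Ioo_inv_pow hn ha.le]
  exact (hinv.integrable_indicator measurableSet_Ioo).integrableOn

theorem integral_indicator_Ioo_norm_inv_pow (hn : n ≠ 0) (ha : 0 < a) (hab : a ≤ b) :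
    ∫ x : Eucl n, (Ioo a b).indicator (fun t => t⁻¹ ^ n) ‖x‖ =
      sphereArea n * Real.log (b / a) := by
  have := nontrivial_eucl hn
  have hinter : Ioi 0 ∩ Ioo a b = Ioo a b := inter_eq_right.2 fun t ht => ha.trans ht.1
  rw [integral_fun_norm_addHaar volume, finrank_euclideanSpace_fin,
    pow_smul_indicator_Ioo_inv_pow hn ha.le, setIntegral_indicator measurableSet_Ioo, hinter,
    ← integral_Ioc_eq_integral_Ioo, ← intervalIntegral.integral_of_le hab,
    integral_inv_of_pos ha (ha.trans_le hab), sphereArea_eq hn, nsmul_eq_mul, smul_eq_mul,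
    mul_assoc]

end Annulus

section Gradient

theorem memLp_gradient {p : ℝ≥0∞} (hφ : ContDiff ℝ 1 φ) (hφc : HasCompactSupport φ) :
    MemLp (gradient φ) p volume :=
  (continuous_gradient hφ).memLp_of_hasCompactSupport (hasCompactSupport_gradient hφc)

theorem integrable_norm_gradient_pow (hn : n ≠ 0) (hφ : ContDiff ℝ 1 φ)
    (hφc : HasCompactSupport φ) : Integrable fun x => ‖gradient φ x‖ ^ n :=
  (memLp_gradient (p := n) hφ hφc).integrable_norm_pow hn

theorem IsTestFunction.gradNorm_eq (hn : n ≠ 0) (hΩ : IsOpen Ω) (hφ : IsTestFunction Ω φ) :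
    gradNorm Ω φ = ENNReal.ofReal ((∫ x, ‖gradient φ x‖ ^ n) ^ (n : ℝ)⁻¹) := by
  have hφ1 : ContDiff ℝ 1 φ := hφ.1.of_le (by simp)
  have hsupp : Function.support (gradient φ) ⊆ Ω := fun x hx => by
    by_contra hxΩ
    exact hx (gradient_eq_zero_of_notMem_tsupport fun h => hxΩ (hφ.2.2 h))
  rw [gradNorm, eLpNorm_congr_ae (weakGrad_ae_eq_gradient hΩ hφ1),
    eLpNorm_restrict_eq_of_support_subset hsupp,
    (memLp_gradient hφ1 hφ.2.1).eLpNorm_eq_integral_rpow_norm (by exact_mod_cast hn) (by simp)]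
  simp only [ENNReal.toReal_natCast, Real.rpow_natCast]

theorem setLIntegral_weakGrad_le (hΩ : IsOpen Ω) (hφ : ContDiff ℝ 1 φ) {S : Set (Eucl n)}
    (hS : MeasurableSet S) (hSΩ : S ⊆ Ω) {m : ℝ} (hm : ∀ x ∈ S, ‖gradient φ x‖ ^ n ≤ m) :
    ∫⁻ x in S, ‖weakGrad Ω φ x‖ₑ ^ n ≤ ENNReal.ofReal m * volume S := by
  have hae : weakGrad Ω φ =ᵐ[volume.restrict S] gradient φ :=
    ae_mono (Measure.restrict_mono hSΩ le_rfl) (weakGrad_ae_eq_gradient hΩ hφ)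
  calc ∫⁻ x in S, ‖weakGrad Ω φ x‖ₑ ^ n = ∫⁻ x in S, ENNReal.ofReal (‖gradient φ x‖ ^ n) := by
        refine lintegral_congr_ae ?_
        filter_upwards [hae] with x hx
        rw [hx, ENNReal.ofReal_pow (norm_nonneg _), ofReal_norm]
    _ ≤ ∫⁻ _ in S, ENNReal.ofReal m :=
        setLIntegral_mono' hS fun x hx => ENNReal.ofReal_le_ofReal (hm x hx)
    _ = ENNReal.ofReal m * volume S := setLIntegral_const _ _

end Gradient

section Energy

/-- The Dirichlet energy `∫ |∇φ|^n` of the Moser function `φ`. -/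
noncomputable def moserEnergy (n : ℕ) (R L : ℝ) : ℝ := ∫ x, ‖gradient (moserFun n R L) x‖ ^ n

/-- The Moser function divided by the `L^n` norm of its gradient. -/
noncomputable def normalizedMoserFun (n : ℕ) (R L : ℝ) (x : Eucl n) : ℝ :=
  (moserEnergy n R L ^ (n : ℝ)⁻¹)⁻¹ * moserFun n R L x

theorem norm_gradient_moserFun_le (hR : 0 < R) (x : Eucl n) :
    ‖gradient (moserFun n R L) x‖ ≤ ‖x‖⁻¹ := by
  rw [norm_gradient_moserFun hR]
  exact mul_le_of_le_one_left (by positivity) (moserSlope_le_one _ _)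

theorem norm_gradient_moserFun_pow_le (hn : n ≠ 0) (hR : 0 < R) (x : Eucl n) :
    ‖gradient (moserFun n R L) x‖ ^ n ≤
      (Ioo (R * Real.exp (-L)) R).indicator (fun t => t⁻¹ ^ n) ‖x‖ := by
  by_cases hx : ‖x‖ ∈ Ioo (R * Real.exp (-L)) R
  · rw [indicator_of_mem hx]
    exact pow_le_pow_left₀ (norm_nonneg _) (norm_gradient_moserFun_le hR x) n
  · rw [indicator_of_notMem hx, norm_gradient_moserFun hR]
    rcases eq_or_ne x 0 with rfl | hx0
    · rw [norm_zero, inv_zero, mul_zero, zero_pow hn]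
    · have hslope : moserSlope L (Real.log R - Real.log ‖x‖) = 0 := by
        rcases le_or_gt ‖x‖ (R * Real.exp (-L)) with hxL | hxL
        · exact moserSlope_of_ge ((le_log_sub_log_iff hR (norm_pos_iff.2 hx0)).2 hxL)
        · have hxR : R ≤ ‖x‖ := not_lt.1 fun h => hx ⟨hxL, h⟩
          exact moserSlope_of_nonpos (sub_nonpos.2 (Real.log_le_log hR hxR))
      rw [hslope, zero_mul, zero_pow hn]

theorem le_norm_gradient_moserFun_pow (hR : 0 < R) (x : Eucl n) :
    (Ioo (R * Real.exp (-(L - 1))) (R * Real.exp (-1))).indicator (fun t => t⁻¹ ^ n) ‖x‖ ≤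
      ‖gradient (moserFun n R L) x‖ ^ n := by
  refine indicator_apply_le' (fun hx => ?_) fun _ => by positivity
  have hx0 : 0 < ‖x‖ := lt_trans (by positivity) hx.1
  rw [norm_gradient_moserFun hR, moserSlope_eq_one ((le_log_sub_log_iff hR hx0).2 hx.2.le)
    ((log_sub_log_le_iff hR hx0).2 hx.1.le), one_mul]

theorem integrable_norm_gradient_moserFun_pow (hn : n ≠ 0) (hR : 0 < R) :
    Integrable fun x => ‖gradient (moserFun n R L) x‖ ^ n :=
  integrable_norm_gradient_pow hn ((contDiff_moserFun hR).of_le (by simp))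
    (hasCompactSupport_moserFun hR)

theorem moserEnergy_le (hn : n ≠ 0) (hR : 0 < R) (hL : 0 ≤ L) :
    moserEnergy n R L ≤ sphereArea n * L := by
  have hρ : 0 < R * Real.exp (-L) := by positivity
  have hρR : R * Real.exp (-L) ≤ R :=
    mul_le_of_le_one_right hR.le (Real.exp_le_one_iff.2 (by linarith))
  refine (integral_mono (integrable_norm_gradient_moserFun_pow hn hR)
    (integrable_indicator_Ioo_norm_inv_pow hn hρ) (norm_gradient_moserFun_pow_le hn hR)).trans_eq ?_
  rw [integral_indicator_Ioo_norm_inv_pow hn hρ hρR, Real.exp_neg, div_mul_cancel_left₀ hR.ne',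
    inv_inv, Real.log_exp]

theorem le_moserEnergy (hn : n ≠ 0) (hR : 0 < R) (hL : 2 ≤ L) :
    sphereArea n * (L - 2) ≤ moserEnergy n R L := by
  have hρ : 0 < R * Real.exp (-(L - 1)) := by positivity
  have hρR : R * Real.exp (-(L - 1)) ≤ R * Real.exp (-1) :=
    mul_le_mul_of_nonneg_left (Real.exp_le_exp.2 (by linarith)) hR.le
  refine Eq.trans_le ?_ (integral_mono (integrable_indicator_Ioo_norm_inv_pow hn hρ)
    (integrable_norm_gradient_moserFun_pow hn hR) (le_norm_gradient_moserFun_pow hR))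
  rw [integral_indicator_Ioo_norm_inv_pow hn hρ hρR, mul_div_mul_left _ _ hR.ne', ← Real.exp_sub,
    Real.log_exp]
  ring

theorem moserEnergy_pos (hn : n ≠ 0) (hR : 0 < R) (hL : 2 < L) : 0 < moserEnergy n R L :=
  (mul_pos (sphereArea_pos hn) (sub_pos.2 hL)).trans_le (le_moserEnergy hn hR hL.le)

end Energy

section Normalized

theorem isTestFunction_normalizedMoserFun (hR : 0 < R) (hRΩ : Metric.closedBall 0 R ⊆ Ω) :
    IsTestFunction Ω (normalizedMoserFun n R L) := by
  refine ⟨contDiff_const.mul (contDiff_moserFun hR), (hasCompactSupport_moserFun hR).mul_left, ?_⟩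
  have hsub : tsupport (normalizedMoserFun n R L) ⊆ tsupport (moserFun n R L) :=
    closure_mono fun x hx => right_ne_zero_of_mul hx
  exact hsub.trans ((tsupport_moserFun_subset hR).trans hRΩ)

theorem norm_gradient_normalizedMoserFun_pow (hn : n ≠ 0) (hR : 0 < R) (x : Eucl n) :
    ‖gradient (normalizedMoserFun n R L) x‖ ^ n =
      (moserEnergy n R L)⁻¹ * ‖gradient (moserFun n R L) x‖ ^ n := by
  have hE : 0 ≤ moserEnergy n R L := integral_nonneg fun _ => by positivity
  have hφ : DifferentiableAt ℝ (moserFun n R L) x :=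
    ((contDiff_moserFun hR).differentiable (by simp)).differentiableAt
  have hderiv : fderiv ℝ (normalizedMoserFun n R L) x =
      (moserEnergy n R L ^ (n : ℝ)⁻¹)⁻¹ • fderiv ℝ (moserFun n R L) x :=
    fderiv_const_mul hφ _
  rw [norm_gradient, norm_gradient, hderiv, norm_smul, mul_pow, norm_inv,
    Real.norm_of_nonneg (Real.rpow_nonneg hE _), inv_pow, Real.rpow_inv_natCast_pow hE hn]

theorem gradNorm_normalizedMoserFun (hn : n ≠ 0) (hΩ : IsOpen Ω) (hR : 0 < R)
    (hRΩ : Metric.closedBall 0 R ⊆ Ω) (hL : 2 < L) :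
    gradNorm Ω (normalizedMoserFun n R L) = 1 := by
  rw [(isTestFunction_normalizedMoserFun hR hRΩ).gradNorm_eq hn hΩ]
  simp only [norm_gradient_normalizedMoserFun_pow hn hR]
  rw [integral_const_mul, ← moserEnergy, inv_mul_cancel₀ (moserEnergy_pos hn hR hL).ne',
    Real.one_rpow, ENNReal.ofReal_one]

theorem normalizedMoserFun_mem_unitBall (hn : n ≠ 0) (hΩ : IsOpen Ω) (hR : 0 < R)
    (hRΩ : Metric.closedBall 0 R ⊆ Ω) (hL : 2 < L) : normalizedMoserFun n R L ∈ unitBall Ω :=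
  ⟨(isTestFunction_normalizedMoserFun hR hRΩ).memW1n0 hΩ,
    (gradNorm_normalizedMoserFun hn hΩ hR hRΩ hL).le⟩

theorem setLIntegral_weakGrad_normalizedMoserFun_le (hn : n ≠ 0) (hΩ : IsOpen Ω) (hR : 0 < R)
    (hRΩ : Metric.closedBall 0 R ⊆ Ω) (hL : 2 < L) {ε : ℝ} (hε : 0 < ε) :
    ∫⁻ x in Ω \ Metric.ball 0 ε, ‖weakGrad Ω (normalizedMoserFun n R L) x‖ₑ ^ n ≤
      ENNReal.ofReal ((sphereArea n * (L - 2))⁻¹ * ε⁻¹ ^ n) * volume Ω := by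
  have : 0 < sphereArea n * (L - 2) := mul_pos (sphereArea_pos hn) (sub_pos.2 hL)
  refine (setLIntegral_weakGrad_le (m := (sphereArea n * (L - 2))⁻¹ * ε⁻¹ ^ n) hΩ
    ((isTestFunction_normalizedMoserFun hR hRΩ).1.of_le (by simp))
    (hΩ.measurableSet.diff Metric.isOpen_ball.measurableSet) sdiff_subset fun x hx => ?_).trans
    (mul_le_mul_right (measure_mono sdiff_subset) _)
  have hεx : ε ≤ ‖x‖ := not_lt.1 fun h => hx.2 (mem_ball_zero_iff.2 h)
  rw [norm_gradient_normalizedMoserFun_pow hn hR]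
  gcongr
  · exact le_moserEnergy hn hR hL.le
  · exact (norm_gradient_moserFun_le hR x).trans (inv_anti₀ hε hεx)

theorem tendsto_setLIntegral_weakGrad_normalizedMoserFun (hn : n ≠ 0) (hΩ : IsOpen Ω)
    (hΩv : volume Ω ≠ ⊤) (hR : 0 < R) (hRΩ : Metric.closedBall 0 R ⊆ Ω) {ε : ℝ} (hε : 0 < ε) :
    Tendsto (fun L => ∫⁻ x in Ω \ Metric.ball 0 ε, ‖weakGrad Ω (normalizedMoserFun n R L) x‖ₑ ^ n)
      atTop (𝓝 0) := by
  refine tendsto_of_tendsto_of_tendsto_of_le_of_le' tendsto_const_nhds ?_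
    (Eventually.of_forall fun _ => zero_le) ((eventually_gt_atTop 2).mono fun L hL =>
      setLIntegral_weakGrad_normalizedMoserFun_le hn hΩ hR hRΩ hL hε)
  have hinv : Tendsto (fun L : ℝ => (sphereArea n * (L - 2))⁻¹ * ε⁻¹ ^ n) atTop
      (𝓝 (0 * ε⁻¹ ^ n)) :=
    (tendsto_inv_atTop_zero.comp ((tendsto_atTop_add_const_right _ (-2) tendsto_id).const_mul_atTop
      (sphereArea_pos hn))).mul_const _
  have hprod := ENNReal.Tendsto.mul_const (ENNReal.tendsto_ofReal hinv) (Or.inr hΩv)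
  rwa [zero_mul, ENNReal.ofReal_zero, zero_mul] at hprod

end Normalized

section Functional

theorem eq_sub_mul_sphereArea_rpow (hn : n ≠ 0) (hαβ : α / alphaCrit n + β / n = 1) :
    α = (n - β) * sphereArea n ^ (1 / ((n : ℝ) - 1)) := by
  have hω : 0 < sphereArea n ^ (1 / ((n : ℝ) - 1)) := Real.rpow_pos_of_pos (sphereArea_pos hn) _
  rw [alphaCrit] at hαβ
  field_simp at hαβ
  linarith

theorem mul_rpow_le_sub_two_rpow {q : ℝ} (hL : 2 ≤ L) (hq : 0 ≤ q) (hq1 : q ≤ 1) :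
    L ^ q * (L - 4) ≤ (L - 2) ^ (1 + q) := by
  have hL0 : 0 < L := by linarith
  have hL2 : 0 ≤ L - 2 := sub_nonneg.2 hL
  have hratio : (L - 2) / L ≤ ((L - 2) / L) ^ q :=
    Real.self_le_rpow_of_le_one (by positivity) ((div_le_one hL0).2 (by linarith)) hq1
  calc L ^ q * (L - 4) ≤ L ^ q * ((L - 2) * ((L - 2) / L)) := by
        gcongr
        rw [← mul_div_assoc, le_div_iff₀ hL0]
        nlinarith
    _ ≤ L ^ q * ((L - 2) * ((L - 2) / L) ^ q) := by gcongr
    _ = (L - 2) ^ (1 + q) := by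
        rw [Real.div_rpow hL2 hL0.le, Real.rpow_add_of_nonneg hL2 zero_le_one hq, Real.rpow_one]
        field_simp

theorem le_mul_abs_normalizedMoserFun_rpow (hn : 2 ≤ n) (hβn : β ≤ n)
    (hαβ : α / alphaCrit n + β / n = 1) (hR : 0 < R) (hL : 2 < L) {x : Eucl n}
    (hx : ‖x‖ ≤ R * Real.exp (-L)) :
    (n - β) * (L - 4) ≤ α * |normalizedMoserFun n R L x| ^ ((n : ℝ) / ((n : ℝ) - 1)) := by
  have hn0 : n ≠ 0 := by omega
  have hn2 : (2 : ℝ) ≤ n := by exact_mod_cast hn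
  have hn1 : (0 : ℝ) < (n : ℝ) - 1 := by linarith
  have hω := sphereArea_pos hn0
  have hE := moserEnergy_pos hn0 hR hL
  set q : ℝ := 1 / ((n : ℝ) - 1) with hq
  have hq0 : 0 ≤ q := by positivity
  have hq1 : q ≤ 1 := (div_le_one hn1).2 (by linarith)
  have hp : (n : ℝ) / ((n : ℝ) - 1) = 1 + q := by rw [hq]; field_simp; ring
  have hfactor : ((moserEnergy n R L ^ (n : ℝ)⁻¹)⁻¹) ^ (1 + q) = (moserEnergy n R L ^ q)⁻¹ := by
    rw [Real.inv_rpow (by positivity), ← Real.rpow_mul hE.le, ← hp, hq]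
    congr 2
    field_simp
  have hprofile : 0 ≤ moserProfile L L :=
    (sub_nonneg.2 hL.le).trans (sub_two_le_moserProfile hL.le)
  have : 0 ≤ (n : ℝ) - β := sub_nonneg.2 hβn
  rw [normalizedMoserFun, moserFun_eq_const hR hx, hp, abs_of_nonneg (by positivity),
    Real.mul_rpow (by positivity) hprofile, hfactor, eq_sub_mul_sphereArea_rpow hn0 hαβ]
  calc ((n : ℝ) - β) * (L - 4)
      = (n - β) * sphereArea n ^ q * (((sphereArea n * L) ^ q)⁻¹ * (L ^ q * (L - 4))) := by
        rw [Real.mul_rpow hω.le (by linarith)]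
        field_simp
    _ ≤ (n - β) * sphereArea n ^ q * (((sphereArea n * L) ^ q)⁻¹ * (L - 2) ^ (1 + q)) := by
        gcongr
        exact mul_rpow_le_sub_two_rpow hL.le hq0 hq1
    _ ≤ (n - β) * sphereArea n ^ q * ((moserEnergy n R L ^ q)⁻¹ * moserProfile L L ^ (1 + q)) := by
        gcongr
        · exact moserEnergy_le hn0 hR (by linarith)
        · exact sub_two_le_moserProfile hL.le

theorem le_F_of_le_on_ball (hn : n ≠ 0) (hβ : 0 ≤ β) {ρ m : ℝ} (hρ : 0 < ρ) (hm : 0 ≤ m)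
    (hρΩ : Metric.ball 0 ρ ⊆ Ω) {v : Eucl n → ℝ}
    (hv : ∀ x ∈ Metric.ball 0 ρ, m ≤ α * |v x| ^ ((n : ℝ) / ((n : ℝ) - 1))) :
    ENNReal.ofReal ((Real.exp m - 1) * ρ ^ ((n : ℝ) - β) *
      volume.real (Metric.ball (0 : Eucl n) 1)) ≤ F α β Ω v := by
  have := nontrivial_eucl hn
  have hexp : 0 ≤ Real.exp m - 1 := sub_nonneg.2 (Real.one_le_exp hm)
  have hvol : volume (Metric.ball (0 : Eucl n) ρ \ {0}) =
      ENNReal.ofReal (ρ ^ n * volume.real (Metric.ball (0 : Eucl n) 1)) := by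
    rw [measure_sdiff_null (measure_singleton _), Measure.addHaar_ball _ _ hρ.le,
      finrank_euclideanSpace_fin, ENNReal.ofReal_mul (by positivity),
      ofReal_measureReal measure_ball_lt_top.ne]
  calc ENNReal.ofReal ((Real.exp m - 1) * ρ ^ ((n : ℝ) - β) *
          volume.real (Metric.ball (0 : Eucl n) 1))
      = ∫⁻ _ in Metric.ball (0 : Eucl n) ρ \ {0}, ENNReal.ofReal ((Real.exp m - 1) / ρ ^ β) := by
        rw [setLIntegral_const, hvol, ← ENNReal.ofReal_mul (by positivity), Real.rpow_sub hρ,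
          Real.rpow_natCast]
        congr 1
        ring
    _ ≤ ∫⁻ x in Metric.ball (0 : Eucl n) ρ \ {0},
          ENNReal.ofReal ((Real.exp (α * |v x| ^ ((n : ℝ) / ((n : ℝ) - 1))) - 1) / ‖x‖ ^ β) := by
        refine setLIntegral_mono' (Metric.isOpen_ball.measurableSet.diff
          (measurableSet_singleton _)) fun x hx => ENNReal.ofReal_le_ofReal ?_
        have hx0 : 0 < ‖x‖ := norm_pos_iff.2 hx.2
        have hxρ : ‖x‖ ≤ ρ := (mem_ball_zero_iff.1 hx.1).le
        have hmv := Real.exp_le_exp.2 (hv x hx.1)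
        gcongr
        linarith
    _ ≤ F α β Ω v := lintegral_mono_set (sdiff_subset.trans hρΩ)

theorem le_F_normalizedMoserFun (hn : 2 ≤ n) (hβ : 0 ≤ β) (hβn : β ≤ n)
    (hαβ : α / alphaCrit n + β / n = 1) (hR : 0 < R) (hRΩ : Metric.closedBall 0 R ⊆ Ω)
    (hL : 5 ≤ L) :
    ENNReal.ofReal ((1 - Real.exp (-(n - β))) * (R * Real.exp (-4)) ^ ((n : ℝ) - β) *
      volume.real (Metric.ball (0 : Eucl n) 1)) ≤ F α β Ω (normalizedMoserFun n R L) := by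
  have hnβ : 0 ≤ (n : ℝ) - β := sub_nonneg.2 hβn
  have hρR : R * Real.exp (-L) ≤ R :=
    mul_le_of_le_one_right hR.le (Real.exp_le_one_iff.2 (by linarith))
  refine le_trans (ENNReal.ofReal_le_ofReal ?_) (le_F_of_le_on_ball (by omega) hβ
    (by positivity : 0 < R * Real.exp (-L)) (mul_nonneg hnβ (by linarith : 0 ≤ L - 4))
    ((Metric.ball_subset_closedBall.trans (Metric.closedBall_subset_closedBall hρR)).trans hRΩ)
    fun x hx => le_mul_abs_normalizedMoserFun_rpow hn hβn hαβ hR (by linarith)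
      (mem_ball_zero_iff.1 hx).le)
  have hscale : (R * Real.exp (-4)) ^ ((n : ℝ) - β) =
      Real.exp ((n - β) * (L - 4)) * (R * Real.exp (-L)) ^ ((n : ℝ) - β) := by
    rw [Real.mul_rpow hR.le (Real.exp_pos _).le, Real.mul_rpow hR.le (Real.exp_pos _).le,
      ← Real.exp_mul, ← Real.exp_mul, mul_left_comm, ← Real.exp_add]
    ring_nf
  have hexp : 1 ≤ Real.exp (-(n - β)) * Real.exp ((n - β) * (L - 4)) := by
    rw [← Real.exp_add]
    exact Real.one_le_exp (by nlinarith)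
  rw [hscale, ← mul_assoc]
  gcongr
  linarith

theorem Fdelta_pos (hn : 2 ≤ n) (hΩ : IsOpen Ω) (hΩv : volume Ω ≠ ⊤) (h0 : (0 : Eucl n) ∈ Ω)
    (hβ : 0 ≤ β) (hβn : β < n) (hαβ : α / alphaCrit n + β / n = 1) : 0 < Fdelta α β Ω 0 := by
  have hn0 : n ≠ 0 := by omega
  obtain ⟨R, hR, hRΩ⟩ := Metric.nhds_basis_closedBall.mem_iff.1 (hΩ.mem_nhds h0)
  set v : ℕ → Eucl n → ℝ := fun j => normalizedMoserFun n R (j + 5) with hv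
  have hL : Tendsto (fun j : ℕ => (j : ℝ) + 5) atTop atTop :=
    tendsto_atTop_add_const_right _ _ tendsto_natCast_atTop_atTop
  have hL5 (j : ℕ) : (5 : ℝ) ≤ j + 5 := by linarith [j.cast_nonneg (α := ℝ)]
  have hL2 (j : ℕ) : (2 : ℝ) < j + 5 := by linarith [hL5 j]
  have hconc : ConcentratesAt Ω v 0 := by
    refine ⟨?_, fun ε hε =>
      (tendsto_setLIntegral_weakGrad_normalizedMoserFun hn0 hΩ hΩv hR hRΩ hε).comp hL⟩
    simp only [hv, gradNorm_normalizedMoserFun hn0 hΩ hR hRΩ (hL2 _), tendsto_const_nhds]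
  have hlower : 0 < (1 - Real.exp (-(n - β))) * (R * Real.exp (-4)) ^ ((n : ℝ) - β) *
      volume.real (Metric.ball (0 : Eucl n) 1) := by
    have hexp : 0 < 1 - Real.exp (-((n : ℝ) - β)) :=
      sub_pos.2 (Real.exp_lt_one_iff.2 (neg_neg_of_pos (sub_pos.2 hβn)))
    have := volume_real_unit_ball_pos n
    positivity
  refine (ENNReal.ofReal_pos.2 hlower).trans_le (le_trans ?_ (le_sSup
    ⟨v, fun j => normalizedMoserFun_mem_unitBall hn0 hΩ hR hRΩ (hL2 j), hconc, rfl⟩))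
  exact le_limsup_of_frequently_le' (Eventually.of_forall fun j =>
    le_F_normalizedMoserFun hn hβ hβn.le hαβ hR hRΩ (hL5 j)).frequently

end Functional

end MoserSequence

section LevelSets

variable {n : ℕ} {Ω : Set (Eucl n)}

theorem tendsto_energy_compl_ball (hn : n ≠ 0) (hΩ : IsOpen Ω) {G : ℕ → Eucl n → Eucl n} {ε : ℝ}
    (hG : Tendsto (fun i => ∫⁻ x in Ω \ Metric.ball 0 ε, ‖G i x‖ₑ ^ n) atTop (𝓝 0)) :
    Tendsto (fun i => (energy (Ω.indicator (G i))).real (Metric.ball 0 ε)ᶜ) atTop (𝓝 0) := by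
  simp only [measureReal_def, energy_indicator_apply hn hΩ.measurableSet
    Metric.isOpen_ball.measurableSet.compl]
  exact (ENNReal.tendsto_toReal ENNReal.zero_ne_top).comp hG

theorem frequently_exists_two_lt {α β r : ℝ} (hn : 2 ≤ n) (hα : 0 < α) (hβ : 0 ≤ β) (hβn : β < n)
    (hΩ : IsOpen Ω) (hΩb : Bornology.IsBounded Ω) {u : ℕ → Eucl n → ℝ}
    (hu : ∀ i, MemW1n0 Ω (u i)) (huc : ∀ i, ContinuousOn (u i) Ω)
    (hu_nonneg : ∀ i, ∀ x ∈ Ω, 0 ≤ u i x)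
    (hconc : ∀ ε, 0 < ε → Tendsto
      (fun i => ∫⁻ x in Ω \ Metric.ball 0 ε, ‖weakGrad Ω (u i) x‖ₑ ^ n) atTop (𝓝 0))
    (hF : ¬ Tendsto (fun i => F α β Ω (u i)) atTop (𝓝 0)) (hr : 0 < r) :
    ∃ᶠ j in atTop, ∃ x ∈ Ω ∩ Metric.ball 0 r, 2 < u j x := by
  contrapose! hF
  refine tendsto_F_zero_of_abs_le_on_ball (B := 2) hn hα hβ hβn hΩ hΩb hu huc
    (fun ε hε => tendsto_energy_compl_ball (by omega) hΩ (hconc ε hε)) hr ?_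
  filter_upwards [hF] with j hj x hx
  exact (abs_of_nonneg (hu_nonneg j x hx.1)).trans_le (hj x hx)

theorem exists_forall_subset_ball_of_isPreconnected_superlevel (hn : n ≠ 0) (hΩ : IsOpen Ω)
    (hΩb : Bornology.IsBounded Ω) {r : ℝ} (hr : 0 < r) :
    ∃ κ > 0, ∀ v, MemW1n0 Ω v → ContinuousOn v Ω →
      (energy (Ω.indicator (weakGrad Ω v))).real (Metric.ball 0 (r / 2))ᶜ < κ →
      ∀ A ⊆ {x ∈ Ω | 1 ≤ v x}, IsPreconnected A → (A ∩ Metric.ball 0 r).Nonempty →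
        A ⊆ Metric.ball 0 (2 * r) := by
  obtain ⟨M, hM, hΩM⟩ := hΩb.subset_ball_lt 0 0
  obtain ⟨κ, hκ, hcross⟩ := exists_forall_subset_ball_of_isPreconnected hn hM.le hr
  refine ⟨κ, hκ, fun v hv hvc hvκ A hAv hA => hcross _ _ (hv.isSobolevLimit hΩ) (fun x hx => ?_)
    hvκ A hA fun x hxA => ⟨continuousAt_indicator_of_mem hΩ hvc (hAv hxA).1, ?_⟩⟩
  · exact indicator_of_notMem (fun hxΩ => hx.not_gt (mem_ball_zero_iff.1 (hΩM hxΩ))) _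
  · rw [indicator_of_mem (hAv hxA).1]
    exact (one_half_lt_one.trans_le (hAv hxA).2).trans_le (le_abs_self _)

end LevelSets

end MoserTrudinger

open MoserTrudinger in
theorem mainTheorem9_general (n : ℕ) (hn : 2 ≤ n) (Ω : Set (EuclideanSpace ℝ (Fin n)))
    (hΩ_open : IsOpen Ω) (hΩ_bdd : Bornology.IsBounded Ω) (hΩ_smooth : HasSmoothBoundary Ω)
    (α β : ℝ) (hα : 0 < α) (hβ : 0 ≤ β) (hβn : β < n)
    (u : ℕ → EuclideanSpace ℝ (Fin n) → ℝ) (hu : ∀ i, MemW1n0 Ω (u i))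
    (hu_smooth : ∀ i, ContDiffOn ℝ ∞ (u i) Ω) (hu_nonneg : ∀ i, ∀ x ∈ Ω, 0 ≤ u i x)
    (hu_conc : ∀ ε : ℝ, 0 < ε → Tendsto
      (fun i => ∫⁻ x in Ω \ Metric.ball 0 ε, ‖weakGrad Ω (u i) x‖ₑ ^ n) atTop (𝓝 0))
    (hu_F : ¬ Tendsto (fun i => F α β Ω (u i)) atTop (𝓝 0)) (r : ℝ) (hr : 0 < r) :
    ∃ j : ℕ, ∃ k ∈ Icc (1 : ℝ) 2,
      ({x ∈ Ω | k ≤ u j x} ∩ Metric.ball 0 r).Nonempty ∧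
      ∀ x ∈ {x ∈ Ω | k ≤ u j x},
        ((connectedComponentIn {x ∈ Ω | k ≤ u j x} x ∩ Metric.ball 0 r).Nonempty →
          connectedComponentIn {x ∈ Ω | k ≤ u j x} x ⊆ Metric.ball 0 (2 * r)) ∧
        HasSmoothBoundary (connectedComponentIn {x ∈ Ω | k ≤ u j x} x) := by
  have hn0 : n ≠ 0 := by omega
  have hu_cont (i : ℕ) : ContinuousOn (u i) Ω := (hu_smooth i).continuousOn
  obtain ⟨κ, hκ, hconfined⟩ :=
    exists_forall_subset_ball_of_isPreconnected_superlevel hn0 hΩ_open hΩ_bdd hr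
  have henergy := (tendsto_energy_compl_ball hn0 hΩ_open
    (hu_conc _ (half_pos hr))).eventually_lt_const hκ
  obtain ⟨j, ⟨x₀, hx₀, hx₀u⟩, hj⟩ := ((frequently_exists_two_lt hn hα hβ hβn hΩ_open hΩ_bdd hu
    hu_cont hu_nonneg hu_conc hu_F hr).and_eventually henergy).exists
  obtain ⟨k, hk, hreg⟩ := exists_mem_Icc_fderiv_ne_zero hΩ_open (hu_smooth j) one_lt_two
  refine ⟨j, k, hk, ⟨x₀, ⟨hx₀.1, hk.2.trans hx₀u.le⟩, hx₀.2⟩, fun x _ => ?_⟩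
  have hsub := connectedComponentIn_subset {x ∈ Ω | k ≤ u j x} x
  refine ⟨hconfined (u j) (hu j) (hu_cont j) hj _
    (fun y hy => ⟨(hsub hy).1, hk.1.trans (hsub hy).2⟩) isPreconnected_connectedComponentIn, ?_⟩
  refine hasSmoothBoundary_connectedComponentIn hΩ_open (hu_smooth j) hreg
    (closure_subset_of_isPreconnected hn0 hΩ_open hΩ_smooth (hu j) (hu_cont j)
      isPreconnected_connectedComponentIn (fun y hy => (hsub hy).1) fun y hy => ?_)
  exact (one_half_lt_one.trans_le (hk.1.trans (hsub hy).2)).trans_le (le_abs_self _)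

theorem mainTheorem9 (n : ℕ) (hn : 2 ≤ n) (Ω : Set (EuclideanSpace ℝ (Fin n)))
    (hΩ_open : IsOpen Ω) (hΩ_bdd : Bornology.IsBounded Ω)
    (hΩ_smooth : MoserTrudinger.HasSmoothBoundary Ω)
    (hΩ_zero : (0 : EuclideanSpace ℝ (Fin n)) ∈ Ω)
    (α β : ℝ) (hα : 0 < α) (hβ : 0 ≤ β) (hβn : β < n)
    (hαβ : α / MoserTrudinger.alphaCrit n + β / n = 1)
    (u : ℕ → EuclideanSpace ℝ (Fin n) → ℝ)
    (hu : ∀ i, u i ∈ MoserTrudinger.unitBall Ω)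
    (hu_smooth : ∀ i, ContDiffOn ℝ ∞ (u i) Ω)
    (hu_nonneg : ∀ i, ∀ x ∈ Ω, 0 ≤ u i x)
    (hu_conc : MoserTrudinger.ConcentratesAt Ω u 0)
    (hu_max : Tendsto (fun i => MoserTrudinger.F α β Ω (u i)) atTop
      (𝓝 (MoserTrudinger.Fdelta α β Ω 0)))
    (r : ℝ) (hr : 0 < r) :
    ∃ j : ℕ, ∃ k ∈ Set.Icc (1 : ℝ) 2,
      ({x ∈ Ω | k ≤ u j x} ∩ Metric.ball 0 r).Nonempty ∧
      ∀ x ∈ {x ∈ Ω | k ≤ u j x},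
        ((connectedComponentIn {x ∈ Ω | k ≤ u j x} x ∩ Metric.ball 0 r).Nonempty →
          connectedComponentIn {x ∈ Ω | k ≤ u j x} x ⊆ Metric.ball 0 (2 * r)) ∧
        MoserTrudinger.HasSmoothBoundary (connectedComponentIn {x ∈ Ω | k ≤ u j x} x) :=
  mainTheorem9_general n hn Ω hΩ_open hΩ_bdd hΩ_smooth α β hα hβ hβn u (fun i => (hu i).1) hu_smooth
    hu_nonneg hu_conc.2 (fun h0 => (MoserTrudinger.Fdelta_pos hn hΩ_open hΩ_bdd.measure_lt_top.ne
      hΩ_zero hβ hβn hαβ).ne' (tendsto_nhds_unique hu_max h0)) r hr
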